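/- Let $\mathcal K$ be a separable complex Hilbert space (inner product linear in the second argument), and let $\dot A$ be a densely defined, closed, symmetric operator in $\mathcal K$ with equal deficiency indices. Let $A$ be a self-adjoint extension of $\dot A$ in $\mathcal K$, let $E_A(\cdot)$ be its spectral measure (so $A=\int_{\mathbb R}\lambda\,dE_A(\lambda)$, $E_A(\lambda)=E_A((-\infty,\lambda])$), let $\mathcal N$ be a closed subspace of $\mathcal K$, and let $P_{\mathcal N}$ be the orthogonal projection onto $\mathcal N$. For $z\in\mathbb C\setminus\mathbb R$ define the Donoghue-type $m$-operator in $\mathcal B(\mathcal N)$ by $$M(z)=M^{Do}_{A,\mathcal N}(z)=P_{\mathcal N}(zA+I)(A-zI)^{-1}P_{\mathcal N}|_{\mathcal N}=zI_{\mathcal N}+(z^2+1)P_{\mathcal N}(A-zI)^{-1}P_{\mathcal N}|_{\mathcal N}.$$ With $\operatorname{Im}T=(T-T^*)/(2i)$, the following hold. 1. $M$ is well defined (the resolvent exists and the two expressions agree) and analytic on $\mathbb C\setminus\mathbb R$, and for all $z\in\mathbb C\setminus\mathbb R$, $$[\operatorname{Im}z]^{-1}\operatorname{Im}M(z)\ \ge\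 \frac{2}{(|z|^2+1)+\big[(|z|^2-1)^2+4(\operatorname{Re}z)^2\big]^{1/2}}\;I_{\mathcal N}.$$ 2. For all $z\in\mathbb C\setminus\mathbb R$, $\operatorname{Im}M(z)$ has an inverse in $\mathcal B(\mathcal N)$. 3. $M$ is a $\mathcal B(\mathcal N)$-valued Nevanlinna–Herglotz function: it is analytic with $\operatorname{Im}M(z)\ge0$ for $\operatorname{Im}z>0$, and $M(z)=M(\overline z)^*$ for $\operatorname{Im}z<0$. 4. The spectral measure $E_A$ exists, and there is a nonnegative, strongly countably additive operator-valued measure $\Omega$, with values in $\mathcal B(\mathcal N)$ on bounded Borel subsets of $\mathbb R$, given by $d\Omega(\lambda)=(\lambda^2+1)\,d\big(P_{\mathcal N}E_A(\lambda)P_{\mathcal N}|_{\mathcal N}\big)$, that is, $d(\xi,\Omega(\lambda)\xi)=(\lambda^2+1)\,d(\xi,E_A(\lambda)\xi)$ for all $\xi\in\mathcal N$, such that, with integrals in the strong operator topology, $$M(z)=\int_{\mathbb R}d\Omega(\lambda)\Big[\frac1{\lambda-z}-\frac{\lambda}{\lambda^2+1}\Big],\quad z\in\mathbb C\setminus\mathbb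 R,\qquad\qquad \int_{\mathbb R}d\Omega(\lambda)\,(1+\lambda^2)^{-1}=I_{\mathcal N}.$$ 5. For $\xi\in\mathcal N$, $\int_{\mathbb R}d(\xi,\Omega(\lambda)\xi)_{\mathcal N}=\infty$ if and only if $\xi\notin\operatorname{dom}(A)$. In particular, if $\mathcal N\subseteq\ker(\dot A^*-z_0I)$ for some $z_0\in\mathbb C\setminus\mathbb R$ (for instance, if $\mathcal N=\ker(\dot A^*-iI)$), then $\int_{\mathbb R}d(\xi,\Omega(\lambda)\xi)_{\mathcal N}=\infty$ for all $\xi\in\mathcal N\setminus\{0\}$. -/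

import Mathlib

open MeasureTheory Filter Topology Set
open scoped InnerProductSpace ENNReal

noncomputable section

/-! ### Symmetric operators, deficiency spaces, resolvents -/

section Operators

variable {K : Type*} [NormedAddCommGroup K] [InnerProductSpace ℂ K] [CompleteSpace K]

/-- The deficiency space `ker (S† - z)` of a densely defined operator `S`. -/
def deficiencySpace (S : K →ₗ.[ℂ] K) (z : ℂ) : Submodule ℂ K where
  carrier := {x | ∃ hx : x ∈ S.adjoint.domain, S.adjoint ⟨x, hx⟩ = z • x}
  zero_mem' := ⟨S.adjoint.domain.zero_mem, by
    rw [smul_zero]; exact S.adjoint.map_zero⟩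
  add_mem' := by
    rintro x y ⟨hx, hx'⟩ ⟨hy, hy'⟩
    refine ⟨S.adjoint.domain.add_mem hx hy, ?_⟩
    rw [smul_add, ← hx', ← hy']
    exact S.adjoint.map_add ⟨x, hx⟩ ⟨y, hy⟩
  smul_mem' := by
    rintro c x ⟨hx, hx'⟩
    refine ⟨S.adjoint.domain.smul_mem c hx, ?_⟩
    rw [smul_comm, ← hx']
    exact S.adjoint.map_smul c ⟨x, hx⟩

/-- The dimension of `ker (S† - z)`, an element of `ℕ ∪ {∞}`. -/
def deficiencyIndex (S : K →ₗ.[ℂ] K) (z : ℂ) : ℕ∞ :=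
  Cardinal.toENat (Module.rank ℂ (deficiencySpace S z))

/-- `S` is densely defined, closed and symmetric, with equal deficiency indices. -/
structure IsClosedSymmetricWithEqualIndices (S : K →ₗ.[ℂ] K) : Prop where
  dense : Dense (S.domain : Set K)
  closed : S.IsClosed
  symmetric : S.IsFormalAdjoint S
  indices : deficiencyIndex S Complex.I = deficiencyIndex S (-Complex.I)

/-- The bounded operator `R` is a two-sided inverse of `A - z : dom A → K`. -/
def IsResolventAt (A : K →ₗ.[ℂ] K) (z : ℂ) (R : K →L[ℂ] K) : Prop :=
  (∀ x : K, ∃ hx : R x ∈ A.domain, A ⟨R x, hx⟩ - z • R x = x) ∧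
    ∀ x : A.domain, R (A x - z • (x : K)) = x

open scoped Classical in
/-- The resolvent `(A - z)⁻¹`, a bounded operator for `z` in the resolvent set of `A`
(and `0` by convention if `z` is not in the resolvent set). -/
def resolventOp (A : K →ₗ.[ℂ] K) (z : ℂ) : K →L[ℂ] K :=
  if h : ∃ R : K →L[ℂ] K, IsResolventAt A z R then h.choose else 0

/-- `P_N T P_N` restricted to `N`, as an operator in `N`. -/
def compress (N : Submodule ℂ K) [N.HasOrthogonalProjection] (T : K →L[ℂ] K) : N →L[ℂ] N :=
  N.orthogonalProjectionOnto ∘L T ∘L N.subtypeL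

/-- The Donoghue-type `m`-operator `z I_N + (z² + 1) P_N (A - z)⁻¹ P_N |_N`. -/
def donoghueM (A : K →ₗ.[ℂ] K) (N : Submodule ℂ K) [N.HasOrthogonalProjection] (z : ℂ) :
    N →L[ℂ] N :=
  z • (1 : N →L[ℂ] N) + (z ^ 2 + 1) • compress N (resolventOp A z)

/-- `Im T = (T - T*) / (2i)`. -/
def opIm (T : K →L[ℂ] K) : K →L[ℂ] K :=
  (1 / (2 * Complex.I)) • (T - ContinuousLinearMap.adjoint T)

/-- `M` is a bounded operator-valued Nevanlinna--Herglotz function, given on `ℂ \ ℝ`: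
analytic with nonnegative imaginary part in the upper half-plane, and extended to the lower
half-plane by reflection. -/
structure IsNevanlinnaHerglotz (M : ℂ → K →L[ℂ] K) : Prop where
  analytic : AnalyticOnNhd ℂ M {z | 0 < z.im}
  im_nonneg : ∀ z : ℂ, 0 < z.im → 0 ≤ opIm (M z)
  reflection : ∀ z : ℂ, z.im < 0 →
    M z = ContinuousLinearMap.adjoint (M (starRingEnd ℂ z))

end Operators

/-! ### Operator-valued measures on `ℝ` -/

/-- A bounded, nonnegative operator-valued measure on the Borel sets of `ℝ`, strongly countably
additive. Values on non-Borel sets are irrelevant. -/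
structure BoundedOperatorMeasure (H : Type*) [NormedAddCommGroup H] [InnerProductSpace ℂ H] where
  toFun : Set ℝ → H →L[ℂ] H
  empty : toFun ∅ = 0
  nonneg : ∀ B, MeasurableSet B → (toFun B).IsPositive
  hasSum : ∀ B : ℕ → Set ℝ, (∀ j, MeasurableSet (B j)) → Pairwise (Function.onFun Disjoint B) →
    ∀ f : H, HasSum (fun j => toFun (B j) f) (toFun (⋃ j, B j) f)

/-- A nonnegative operator-valued measure on `ℝ`, whose values on *bounded* Borel sets are bounded
operators, strongly countably additive. Values on other sets are irrelevant. -/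
structure LocalOperatorMeasure (H : Type*) [NormedAddCommGroup H] [InnerProductSpace ℂ H] where
  toFun : Set ℝ → H →L[ℂ] H
  empty : toFun ∅ = 0
  nonneg : ∀ B, MeasurableSet B → Bornology.IsBounded B → (toFun B).IsPositive
  hasSum : ∀ B : ℕ → Set ℝ, (∀ j, MeasurableSet (B j)) → Pairwise (Function.onFun Disjoint B) →
    Bornology.IsBounded (⋃ j, B j) →
    ∀ f : H, HasSum (fun j => toFun (B j) f) (toFun (⋃ j, B j) f)

section OperatorMeasures

variable {H : Type*} [NormedAddCommGroup H] [InnerProductSpace ℂ H]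

/-- The scalar measure `B ↦ (ξ, S(B) ξ)`. -/
def BoundedOperatorMeasure.scalar (S : BoundedOperatorMeasure H) (ξ : H) : Measure ℝ :=
  Measure.ofMeasurable (fun B _ => ENNReal.ofReal (⟪ξ, S.toFun B ξ⟫_ℂ).re)
    (by simp [S.empty])
    (by
      intro B hB hd
      have h1 := (S.hasSum B hB hd ξ).mapL (innerSL ℂ ξ)
      have h2 := Complex.hasSum_re h1
      simp only [innerSL_apply_apply] at h2
      rw [← h2.tsum_eq, ENNReal.ofReal_tsum_of_nonneg _ h2.summable]
      intro j
      exact (S.nonneg _ (hB j)).re_inner_nonneg_right ξ)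

theorem BoundedOperatorMeasure.scalar_apply (S : BoundedOperatorMeasure H) (ξ : H)
    {B : Set ℝ} (hB : MeasurableSet B) :
    S.scalar ξ B = ENNReal.ofReal (⟪ξ, S.toFun B ξ⟫_ℂ).re :=
  Measure.ofMeasurable_apply B hB

/-- The bounded operator-valued measure `B ↦ Ω (B ∩ s)`, for a bounded Borel set `s`. -/
def LocalOperatorMeasure.restrict (Ω : LocalOperatorMeasure H) (s : Set ℝ)
    (hs : MeasurableSet s) (hb : Bornology.IsBounded s) : BoundedOperatorMeasure H where
  toFun B := Ω.toFun (B ∩ s)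
  empty := by simp [Ω.empty]
  nonneg B hB := Ω.nonneg _ (hB.inter hs) (hb.subset inter_subset_right)
  hasSum B hB hd f := by
    rw [iUnion_inter]
    refine Ω.hasSum _ (fun j => (hB j).inter hs) ?_ ?_ f
    · intro i j hij
      exact (hd hij).mono inter_subset_left inter_subset_left
    · exact hb.subset (iUnion_subset fun j => inter_subset_right)

/-- The scalar measure `(ξ, Ω(·) ξ)` on `ℝ`: the sum over `k ∈ ℤ` of the measures
`B ↦ (ξ, Ω(B ∩ (k, k + 1]) ξ)`. -/
def LocalOperatorMeasure.scalar (Ω : LocalOperatorMeasure H) (ξ : H) : Measure ℝ :=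
  Measure.sum fun k : ℤ =>
    (Ω.restrict (Ioc (k : ℝ) (k + 1)) measurableSet_Ioc (Metric.isBounded_Ioc _ _)).scalar ξ

theorem LocalOperatorMeasure.scalar_apply (Ω : LocalOperatorMeasure H) (ξ : H)
    {B : Set ℝ} (hB : MeasurableSet B) (hb : Bornology.IsBounded B) :
    Ω.scalar ξ B = ENNReal.ofReal (⟪ξ, Ω.toFun B ξ⟫_ℂ).re := by
  have hr : Ω.scalar ξ B =
      ∑' k : ℤ, (Ω.restrict B hB hb).scalar ξ (Ioc (k : ℝ) (k + 1)) := by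
    rw [LocalOperatorMeasure.scalar, Measure.sum_apply _ hB]
    refine tsum_congr fun k => ?_
    rw [BoundedOperatorMeasure.scalar_apply _ _ hB,
      BoundedOperatorMeasure.scalar_apply _ _ measurableSet_Ioc]
    simp only [LocalOperatorMeasure.restrict, inter_comm]
  rw [hr, ← measure_iUnion (fun i j hij => pairwise_disjoint_Ioc_intCast ℝ hij)
    (fun k => measurableSet_Ioc), iUnion_Ioc_intCast,
    BoundedOperatorMeasure.scalar_apply _ _ MeasurableSet.univ]
  simp only [LocalOperatorMeasure.restrict, univ_inter]

/-- The integral `∫_B s dΩ = ∑ c • Ω({s = c} ∩ B)` of a simple function. -/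
def LocalOperatorMeasure.simpleIntegral (Ω : LocalOperatorMeasure H) (B : Set ℝ)
    (s : SimpleFunc ℝ ℂ) : H →L[ℂ] H :=
  ∑ c ∈ s.range, c • Ω.toFun (s ⁻¹' {c} ∩ B)

/-- `T = ∫_B dΩ(λ) f(λ)` in the strong operator topology, for a bounded Borel set `B`: `f` is on
`B` a uniform limit of simple functions, the integrals of which converge strongly to `T`. -/
def LocalOperatorMeasure.HasStrongIntegralOn (Ω : LocalOperatorMeasure H) (B : Set ℝ)
    (f : ℝ → ℂ) (T : H →L[ℂ] H) : Prop :=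
  ∃ s : ℕ → SimpleFunc ℝ ℂ, TendstoUniformlyOn (fun n t => s n t) f atTop B ∧
    ∀ ξ : H, Tendsto (fun n => Ω.simpleIntegral B (s n) ξ) atTop (𝓝 (T ξ))

/-- `T = ∫_ℝ dΩ(λ) f(λ)` in the strong operator topology: the integrals of `f` over bounded Borel
sets exist, and they converge strongly to `T` along every sequence of bounded Borel sets that
increases to `ℝ`. -/
def LocalOperatorMeasure.HasStrongIntegral (Ω : LocalOperatorMeasure H)
    (f : ℝ → ℂ) (T : H →L[ℂ] H) : Prop :=
  ∃ J : Set ℝ → H →L[ℂ] H,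
    (∀ B, MeasurableSet B → Bornology.IsBounded B → Ω.HasStrongIntegralOn B f (J B)) ∧
    ∀ B : ℕ → Set ℝ, (∀ n, MeasurableSet (B n)) → (∀ n, Bornology.IsBounded (B n)) →
      Monotone B → ⋃ n, B n = univ →
      ∀ ξ : H, Tendsto (fun n => J (B n) ξ) atTop (𝓝 (T ξ))

end OperatorMeasures

/-! ### Spectral measures -/

/-- A spectral measure: a projection-valued operator measure of total mass `I`. The associated
family of spectral projections is `E(λ) = E((-∞, λ])`. -/
structure SpectralMeasure (K : Type*) [NormedAddCommGroup K] [InnerProductSpace ℂ K]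
    extends BoundedOperatorMeasure K where
  proj : ∀ B, MeasurableSet B → toFun B ∘L toFun B = toFun B
  total : toFun univ = 1

section SpectralMeasures

variable {K : Type*} [NormedAddCommGroup K] [InnerProductSpace ℂ K]

/-- `E` is the spectral measure of `A`, that is, `A = ∫ λ dE(λ)`: the domain of `A` consists of all
`x` with `∫ λ² d(x, E(λ) x) < ∞`, and `(x, A x) = ∫ λ d(x, E(λ) x)` for such `x`. -/
structure SpectralMeasure.IsSpectralMeasureOf (E : SpectralMeasure K) (A : K →ₗ.[ℂ] K) : Prop where
  mem_domain_iff : ∀ x : K, x ∈ A.domain ↔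
    ∫⁻ t, ENNReal.ofReal (t ^ 2) ∂(E.scalar x) < ∞
  inner_apply : ∀ x : A.domain, ⟪(x : K), A x⟫_ℂ = ((∫ t, t ∂(E.scalar (x : K)) : ℝ) : ℂ)

/-- The bounded `B(N)`-valued measure `P_N S(·) P_N |_N`. -/
def BoundedOperatorMeasure.compress (S : BoundedOperatorMeasure K) (N : Submodule ℂ K)
    [N.HasOrthogonalProjection] : BoundedOperatorMeasure N where
  toFun B := N.orthogonalProjectionOnto ∘L S.toFun B ∘L N.subtypeL
  empty := by ext; simp [S.empty]
  nonneg B hB := by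
    have h := S.nonneg B hB
    refine ⟨fun x y => ?_, fun x => ?_⟩
    · have := h.1 (x : K) (y : K)
      simpa using this
    · have := h.2 (x : K)
      simpa [ContinuousLinearMap.reApplyInnerSelf] using this
  hasSum B hB hd f := (S.hasSum B hB hd (f : K)).mapL N.orthogonalProjectionOnto

end SpectralMeasures

end

/-! ### Quadratic forms of operators -/

section Forms

/-! Everything is read off from the spectral theorem. Since (A - z)⁻¹ = ∫ (t - z)⁻¹ dE(t), the
operator M(z) is the compression to N of ∫ k_z dE with the bounded kernel k_z(t) = z + (z² + 1)/(t -
z) = (1 + tz)/(t - z) (`donoghueM_eq_compressL`), and each claim becomes one about scalar functions.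
One has Im k_z(t) = Im z · (t² + 1)/|t - z|², and the constant in the lower bound is a lower bound
of (t² + 1)/|t - z|² over real t (`le_poissonRatio`). Coercivity then makes Im M(z) invertible, and
reflection is conjugation of the kernel. Analyticity comes from the resolvent identity.

The measure is Ω(B) = P_N ∫_B (t² + 1) dE |_N, a bounded operator for bounded B. Multiplying 1/(t -
z) - t/(t² + 1) by t² + 1 gives exactly k_z, and multiplying 1/(1 + t²) by it gives 1. Both products
are bounded, so the integrals over increasing bounded sets converge strongly
(`hasStrongIntegral_donoghueMeasure`). The total mass of (ξ, Ωξ) is ∫ t² d(ξ, Eξ) + ‖ξ‖², infinite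
exactly off dom A. A vector of ker(Ȧ* - z₀) lying in dom A would be an eigenvector of A with nonreal
eigenvalue, hence zero.

Two foundations are built on the way. The bounded Borel calculus of a spectral measure is defined
through quadratic forms; its multiplicativity comes from commutation with the spectral projections
(`commute_toFun_borelCalc`). The spectral measure of A (`exists_spectralMeasure`) comes from the
continuous functional calculus of the normal operator (A - i)⁻¹: Riesz–Markov gives scalar measures,
these give projections, and everything is transported from the spectrum to ℝ. For any E whose
quadratic form and form domain give A, `IsSpectralMeasureOf.isResolventAt` identifies the resolvents
of A. -/

theorem inner_polarization {V K : Type*} [AddCommGroup V] [Module ℂ V] [NormedAddCommGroup K]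
    [InnerProductSpace ℂ K] (S T : V →ₗ[ℂ] K) (x y : V) :
    ⟪S x, T y⟫_ℂ = (⟪S (x + y), T (x + y)⟫_ℂ - ⟪S (x - y), T (x - y)⟫_ℂ
      - Complex.I * ⟪S (x + Complex.I • y), T (x + Complex.I • y)⟫_ℂ
      + Complex.I * ⟪S (x - Complex.I • y), T (x - Complex.I • y)⟫_ℂ) / 4 := by
  simp only [map_add, map_sub, inner_add_left, inner_add_right, map_smul, inner_smul_left,
    inner_smul_right, Complex.conj_I, inner_sub_left, inner_sub_right]
  linear_combination ((1 / 2 : ℂ) * ⟪S x, T y⟫_ℂ - (1 / 2 : ℂ) * ⟪S y, T x⟫_ℂ) * Complex.I_sq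

/-- No topology on `V` and no continuity is assumed, so this applies to A composed with a resolvent
before that product is known to be bounded. -/
theorem inner_eq_of_forall_inner_self {V K : Type*} [AddCommGroup V] [Module ℂ V]
    [NormedAddCommGroup K] [InnerProductSpace ℂ K] {S T T' : V →ₗ[ℂ] K}
    (h : ∀ v, ⟪S v, T v⟫_ℂ = ⟪S v, T' v⟫_ℂ) (x y : V) : ⟪S x, T y⟫_ℂ = ⟪S x, T' y⟫_ℂ := by
  rw [inner_polarization S T, inner_polarization S T', h, h, h, h]

variable {K : Type*} [NormedAddCommGroup K] [InnerProductSpace ℂ K]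

theorem inner_self_eq_ofReal (x : K) : ⟪x, x⟫_ℂ = ((‖x‖ ^ 2 : ℝ) : ℂ) := by
  rw [inner_self_eq_norm_sq_to_K, Complex.ofReal_pow]
  rfl

theorem clm_ext_inner {S T : K →L[ℂ] K} (h : ∀ x, ⟪x, S x⟫_ℂ = ⟪x, T x⟫_ℂ) : S = T := by
  ext y
  refine ext_inner_left ℂ fun x => ?_
  exact inner_eq_of_forall_inner_self (S := LinearMap.id) (T := S.toLinearMap)
    (T' := T.toLinearMap) h x y

theorem clm_inner_polarization (T : K →L[ℂ] K) (x y : K) :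
    ⟪x, T y⟫_ℂ = (⟪x + y, T (x + y)⟫_ℂ - ⟪x - y, T (x - y)⟫_ℂ
      - Complex.I * ⟪x + Complex.I • y, T (x + Complex.I • y)⟫_ℂ
      + Complex.I * ⟪x - Complex.I • y, T (x - Complex.I • y)⟫_ℂ) / 4 :=
  inner_polarization LinearMap.id T.toLinearMap x y

/-- The numerical radius controls the norm up to the factor 2, by polarization and the parallelogram
law. -/
theorem norm_apply_le_of_norm_inner_self_le {T : K →L[ℂ] K} {C : ℝ}
    (h : ∀ x, ‖⟪x, T x⟫_ℂ‖ ≤ C * ‖x‖ ^ 2) (y : K) : ‖T y‖ ≤ 2 * C * ‖y‖ := by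
  have key : ∀ x, ‖⟪x, T y⟫_ℂ‖ ≤ C * (‖x‖ ^ 2 + ‖y‖ ^ 2) := by
    intro x
    rw [clm_inner_polarization, norm_div]
    have e1 := parallelogram_law_with_norm ℂ x y
    have e2 := parallelogram_law_with_norm ℂ x (Complex.I • y)
    rw [norm_smul, Complex.norm_I, one_mul] at e2
    have h1 := h (x + y)
    have h2 := h (x - y)
    have h3 := h (x + Complex.I • y)
    have h4 := h (x - Complex.I • y)
    have n4 : ‖(4 : ℂ)‖ = 4 := by norm_num
    rw [n4, div_le_iff₀ (by norm_num)]
    refine (norm_add_le _ _).trans ?_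
    have := (norm_sub_le (⟪x + y, T (x + y)⟫_ℂ - ⟪x - y, T (x - y)⟫_ℂ)
      (Complex.I * ⟪x + Complex.I • y, T (x + Complex.I • y)⟫_ℂ))
    have := norm_sub_le (⟪x + y, T (x + y)⟫_ℂ) (⟪x - y, T (x - y)⟫_ℂ)
    simp only [norm_mul, Complex.norm_I, one_mul] at *
    -- The parallelogram laws for x, y and for x, iy turn the four squared norms into 4(‖x‖² +
    -- ‖y‖²).
    have e : C * (‖x‖ ^ 2 + ‖y‖ ^ 2) * 4 = C * ‖x + y‖ ^ 2 + C * ‖x - y‖ ^ 2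
      + C * ‖x + Complex.I • y‖ ^ 2 + C * ‖x - Complex.I • y‖ ^ 2 := by
      linear_combination (-C) * e1 + (-C) * e2
    linarith
  rcases eq_or_ne (T y) 0 with h0 | h0
  · rw [h0, norm_zero]
    rcases eq_or_ne y 0 with hy | hy
    · simp [hy]
    · have := (norm_nonneg _).trans (h y)
      have hC : 0 ≤ C := nonneg_of_mul_nonneg_left this (by positivity)
      positivity
  · have ha : 0 < ‖T y‖ := norm_pos_iff.2 h0
    have hy : 0 < ‖y‖ := norm_pos_iff.2 (by rintro rfl; simp at h0)
    -- The test vector is Ty rescaled to have norm ‖y‖.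
    have k := key (((‖y‖ / ‖T y‖ : ℝ) : ℂ) • T y)
    rw [inner_smul_left, inner_self_eq_norm_sq_to_K, norm_smul, Complex.norm_real, norm_mul,
      Complex.conj_ofReal, Complex.norm_real, Real.norm_of_nonneg (by positivity),
      norm_pow] at k
    simp only [Complex.coe_algebraMap, Complex.norm_real, norm_norm] at k
    rw [div_mul_cancel₀ _ ha.ne'] at k
    have e : ‖y‖ / ‖T y‖ * ‖T y‖ ^ 2 = ‖y‖ * ‖T y‖ := by field_simp
    rw [e] at k
    have : ‖y‖ * ‖T y‖ ≤ ‖y‖ * (2 * C * ‖y‖) := by linarith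
    exact le_of_mul_le_mul_left this hy

/-- Polarization turns convergence of the quadratic forms into convergence of all matrix elements,
and the numerical radius bound makes the limiting sesquilinear form bounded, hence represented by an
operator. -/
theorem exists_weak_limit [CompleteSpace K] {T : ℕ → K →L[ℂ] K} {C : ℝ}
    (hC : ∀ n x, ‖⟪x, T n x⟫_ℂ‖ ≤ C * ‖x‖ ^ 2) {q : K → ℂ}
    (hq : ∀ x, Tendsto (fun n => ⟪x, T n x⟫_ℂ) atTop (𝓝 (q x))) :
    ∃ S : K →L[ℂ] K, (∀ x, ⟪x, S x⟫_ℂ = q x) ∧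
      ∀ x y, Tendsto (fun n => ⟪x, T n y⟫_ℂ) atTop (𝓝 ⟪x, S y⟫_ℂ) := by
  have hlim : ∀ x y, ∃ b, Tendsto (fun n => ⟪x, T n y⟫_ℂ) atTop (𝓝 b) := by
    intro x y
    simp_rw [fun n => clm_inner_polarization (T n) x y]
    exact ⟨_, ((((hq _).sub (hq _)).sub ((hq _).const_mul _)).add ((hq _).const_mul _)).div_const _⟩
  choose b hb using hlim
  have hbd : ∀ x y, ‖b x y‖ ≤ 2 * C * ‖x‖ * ‖y‖ := by
    intro x y
    refine le_of_tendsto (hb x y).norm (Eventually.of_forall fun n => ?_)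
    calc ‖⟪x, T n y⟫_ℂ‖ ≤ ‖x‖ * ‖T n y‖ := norm_inner_le_norm _ _
      _ ≤ ‖x‖ * (2 * C * ‖y‖) := by
        gcongr; exact norm_apply_le_of_norm_inner_self_le (hC n) y
      _ = _ := by ring
  let B : K →L⋆[ℂ] K →L[ℂ] ℂ := LinearMap.mkContinuous₂ (LinearMap.mk₂'ₛₗ (starRingEnd ℂ)
    (RingHom.id ℂ) b
    (fun x x' y => tendsto_nhds_unique (hb _ _)
      (by simpa only [inner_add_left] using (hb x y).add (hb x' y)))
    (fun c x y => tendsto_nhds_unique (hb _ _)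
      (by simpa only [inner_smul_left, smul_eq_mul] using (hb x y).const_mul _))
    (fun x y y' => tendsto_nhds_unique (hb _ _)
      (by simpa only [map_add, inner_add_right] using (hb x y).add (hb x y')))
    (fun c x y => tendsto_nhds_unique (hb _ _)
      (by simpa only [map_smul, inner_smul_right, smul_eq_mul, RingHom.id_apply]
        using (hb x y).const_mul _))) (2 * C) hbd
  -- `continuousLinearMapOfBilin` puts its operator in the first slot of the inner product; the
  -- adjoint moves it to the second.
  have hS : ∀ x y, ⟪x, ContinuousLinearMap.adjoint
      (InnerProductSpace.continuousLinearMapOfBilin B) y⟫_ℂ = b x y := by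
    intro x y
    rw [ContinuousLinearMap.adjoint_inner_right,
      InnerProductSpace.continuousLinearMapOfBilin_apply]
    rfl
  refine ⟨ContinuousLinearMap.adjoint (InnerProductSpace.continuousLinearMapOfBilin B), ?_, ?_⟩
  · intro x
    rw [hS]
    exact tendsto_nhds_unique (hb x x) (hq x)
  · intro x y
    rw [hS]
    exact hb x y

end Forms

/-! ### The bounded Borel functional calculus of a spectral measure -/

/-- A bounded Borel function on `ℝ`. -/
def IsBoundedBorel (f : ℝ → ℂ) : Prop := Measurable f ∧ ∃ C, ∀ t, ‖f t‖ ≤ C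

namespace IsBoundedBorel

variable {f g : ℝ → ℂ}

theorem of_bound (hf : Measurable f) (C : ℝ) (h : ∀ t, ‖f t‖ ≤ C) : IsBoundedBorel f :=
  ⟨hf, C, h⟩

theorem const (c : ℂ) : IsBoundedBorel fun _ => c := ⟨measurable_const, ‖c‖, fun _ => le_rfl⟩

theorem add (hf : IsBoundedBorel f) (hg : IsBoundedBorel g) :
    IsBoundedBorel fun t => f t + g t := by
  obtain ⟨hf, C, hC⟩ := hf
  obtain ⟨hg, D, hD⟩ := hg
  exact ⟨hf.add hg, C + D, fun t => (norm_add_le _ _).trans (add_le_add (hC t) (hD t))⟩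

theorem mul (hf : IsBoundedBorel f) (hg : IsBoundedBorel g) :
    IsBoundedBorel fun t => f t * g t := by
  obtain ⟨hf, C, hC⟩ := hf
  obtain ⟨hg, D, hD⟩ := hg
  refine ⟨hf.mul hg, C * D, fun t => ?_⟩
  rw [norm_mul]
  exact mul_le_mul (hC t) (hD t) (norm_nonneg _) ((norm_nonneg _).trans (hC t))

theorem sub (hf : IsBoundedBorel f) (hg : IsBoundedBorel g) :
    IsBoundedBorel fun t => f t - g t := by
  simpa [sub_eq_add_neg] using hf.add ((const (-1)).mul hg)

theorem conj (hf : IsBoundedBorel f) : IsBoundedBorel fun t => starRingEnd ℂ (f t) := by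
  obtain ⟨hf, C, hC⟩ := hf
  exact ⟨Complex.continuous_conj.measurable.comp hf, C, fun t => by rw [RCLike.norm_conj]; exact hC t⟩

theorem indicator (hf : IsBoundedBorel f) {B : Set ℝ} (hB : MeasurableSet B) :
    IsBoundedBorel (B.indicator f) := by
  obtain ⟨hf, C, hC⟩ := hf
  exact ⟨hf.indicator hB, C, fun t => (norm_indicator_le_norm_self _ _).trans (hC t)⟩

theorem simpleFunc (s : SimpleFunc ℝ ℂ) : IsBoundedBorel s := by
  obtain ⟨C, hC⟩ := s.exists_forall_norm_le
  exact ⟨s.measurable, C, hC⟩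

theorem integrable (hf : IsBoundedBorel f) (μ : Measure ℝ) [IsFiniteMeasure μ] :
    Integrable f μ := by
  obtain ⟨hf, C, hC⟩ := hf
  exact Integrable.of_bound hf.aestronglyMeasurable C (ae_of_all _ hC)

end IsBoundedBorel

namespace BoundedOperatorMeasure

variable {H : Type*} [NormedAddCommGroup H] [InnerProductSpace ℂ H] (S : BoundedOperatorMeasure H)

instance (x : H) : IsFiniteMeasure (S.scalar x) :=
  ⟨by rw [S.scalar_apply x MeasurableSet.univ]; exact ENNReal.ofReal_lt_top⟩

theorem inner_toFun (x : H) {B : Set ℝ} (hB : MeasurableSet B) :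
    ⟪x, S.toFun B x⟫_ℂ = ((S.scalar x).real B : ℂ) := by
  have h := (S.nonneg B hB).inner_nonneg_right x
  rw [measureReal_def, S.scalar_apply x hB, ENNReal.toReal_ofReal]
  · exact (Complex.eq_re_of_ofReal_le (r := 0) (by simpa using h))
  · exact (S.nonneg B hB).re_inner_nonneg_right x

theorem measure_eq_scalar {x : H} {μ : Measure ℝ} [IsFiniteMeasure μ]
    (h : ∀ B, MeasurableSet B → ⟪x, S.toFun B x⟫_ℂ = (μ.real B : ℂ)) : S.scalar x = μ := by
  ext B hB
  have h1 := h B hB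
  rw [S.inner_toFun x hB, Complex.ofReal_inj] at h1
  exact (measureReal_eq_measureReal_iff).1 h1

end BoundedOperatorMeasure

namespace SpectralMeasure

variable {K : Type*} [NormedAddCommGroup K] [InnerProductSpace ℂ K] (E : SpectralMeasure K)

theorem scalar_real_univ (x : K) : (E.scalar x).real univ = ‖x‖ ^ 2 := by
  have h := E.inner_toFun x MeasurableSet.univ
  rw [E.total, one_apply_eq_self, inner_self_eq_ofReal] at h
  exact Complex.ofReal_injective h.symm

theorem norm_integral_scalar_le {f : ℝ → ℂ} {C : ℝ} (hC : ∀ t, ‖f t‖ ≤ C) (x : K) :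
    ‖∫ t, f t ∂E.scalar x‖ ≤ C * ‖x‖ ^ 2 := by
  rw [← E.scalar_real_univ]
  exact norm_integral_le_of_norm_le_const (ae_of_all _ hC)

theorem tendsto_integral_scalar {f : ℝ → ℂ} {F : ℕ → ℝ → ℂ} {C : ℝ} (hF : ∀ n, Measurable (F n))
    (hC : ∀ n t, ‖F n t‖ ≤ C) (h : ∀ t, Tendsto (fun n => F n t) atTop (𝓝 (f t))) (x : K) :
    Tendsto (fun n => ∫ t, F n t ∂E.scalar x) atTop (𝓝 (∫ t, f t ∂E.scalar x)) :=
  tendsto_integral_of_dominated_convergence (fun _ => C)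
    (fun n => (hF n).aestronglyMeasurable) (integrable_const C) (fun n => ae_of_all _ (hC n))
    (ae_of_all _ h)

theorem exists_simple_calc (s : SimpleFunc ℝ ℂ) :
    ∃ T : K →L[ℂ] K, ∀ x, ⟪x, T x⟫_ℂ = ∫ t, s t ∂E.scalar x := by
  refine ⟨∑ c ∈ s.range, c • E.toFun (s ⁻¹' {c}), fun x => ?_⟩
  rw [s.integral_eq_sum s.integrable_of_isFiniteMeasure, sum_apply, inner_sum]
  refine Finset.sum_congr rfl fun c _ => ?_
  rw [smul_apply, inner_smul_right,
    E.inner_toFun x (s.measurableSet_fiber c), Complex.real_smul, mul_comm]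

theorem toFun_mul_self {B : Set ℝ} (hB : MeasurableSet B) : E.toFun B * E.toFun B = E.toFun B :=
  E.proj B hB

theorem toFun_union {B C : Set ℝ} (hB : MeasurableSet B) (hC : MeasurableSet C)
    (h : Disjoint B C) : E.toFun (B ∪ C) = E.toFun B + E.toFun C :=
  clm_ext_inner fun x => by
    rw [add_apply, inner_add_right, E.inner_toFun x hB, E.inner_toFun x hC,
      E.inner_toFun x (hB.union hC), measureReal_union h hC, Complex.ofReal_add]

open scoped Classical in
/-- The operator `∫ f dE`, for a bounded Borel function `f`. -/
noncomputable def borelCalc (f : ℝ → ℂ) : K →L[ℂ] K :=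
  if h : ∃ T : K →L[ℂ] K, ∀ x, ⟪x, T x⟫_ℂ = ∫ t, f t ∂E.scalar x then h.choose else 0

variable {f g : ℝ → ℂ}

theorem borelCalc_eq {T : K →L[ℂ] K} (h : ∀ x, ⟪x, T x⟫_ℂ = ∫ t, f t ∂E.scalar x) :
    E.borelCalc f = T := by
  have h' : ∃ T : K →L[ℂ] K, ∀ x, ⟪x, T x⟫_ℂ = ∫ t, f t ∂E.scalar x := ⟨T, h⟩
  rw [borelCalc, dif_pos h']
  exact clm_ext_inner fun x => by rw [h'.choose_spec x, h x]

theorem borelCalc_zero : E.borelCalc (fun _ => 0) = 0 := E.borelCalc_eq fun x => by simp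

theorem borelCalc_one : E.borelCalc (fun _ => 1) = 1 := E.borelCalc_eq fun x => by
  simp [E.scalar_real_univ]

theorem borelCalc_indicator_one {B : Set ℝ} (hB : MeasurableSet B) :
    E.borelCalc (B.indicator fun _ => 1) = E.toFun B := E.borelCalc_eq fun x => by
  rw [E.inner_toFun x hB, integral_indicator_const _ hB]
  simp

variable [CompleteSpace K]

theorem exists_calc {f : ℝ → ℂ} (hf : IsBoundedBorel f) :
    ∃ T : K →L[ℂ] K, ∀ x, ⟪x, T x⟫_ℂ = ∫ t, f t ∂E.scalar x := by
  obtain ⟨hf, C, hC⟩ := hf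
  let s : ℕ → SimpleFunc ℝ ℂ := SimpleFunc.approxOn f hf univ 0 (mem_univ _)
  have hs : ∀ n t, ‖s n t‖ ≤ C + C := fun n t =>
    (SimpleFunc.norm_approxOn_zero_le hf (mem_univ _) t n).trans (add_le_add (hC t) (hC t))
  choose T hT using fun n => E.exists_simple_calc (s n)
  obtain ⟨S, hS, -⟩ := exists_weak_limit (T := T) (C := C + C)
    (q := fun x => ∫ t, f t ∂E.scalar x)
    (fun n x => by rw [hT]; exact E.norm_integral_scalar_le (hs n) x)
    (fun x => by
      simp_rw [hT]
      exact E.tendsto_integral_scalar (fun n => (s n).measurable) hs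
        (fun t => SimpleFunc.tendsto_approxOn hf _ (by simp)) x)
  exact ⟨S, hS⟩

theorem inner_borelCalc (hf : IsBoundedBorel f) (x : K) :
    ⟪x, E.borelCalc f x⟫_ℂ = ∫ t, f t ∂E.scalar x := by
  rw [borelCalc, dif_pos (E.exists_calc hf)]
  exact (E.exists_calc hf).choose_spec x

theorem borelCalc_add (hf : IsBoundedBorel f) (hg : IsBoundedBorel g) :
    E.borelCalc (fun t => f t + g t) = E.borelCalc f + E.borelCalc g :=
  E.borelCalc_eq fun x => by
    rw [add_apply, inner_add_right, E.inner_borelCalc hf,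
      E.inner_borelCalc hg, integral_add (hf.integrable _) (hg.integrable _)]

theorem borelCalc_sub (hf : IsBoundedBorel f) (hg : IsBoundedBorel g) :
    E.borelCalc (fun t => f t - g t) = E.borelCalc f - E.borelCalc g :=
  E.borelCalc_eq fun x => by
    rw [sub_apply, inner_sub_right, E.inner_borelCalc hf,
      E.inner_borelCalc hg, integral_sub (hf.integrable _) (hg.integrable _)]

theorem borelCalc_smul (c : ℂ) (hf : IsBoundedBorel f) :
    E.borelCalc (fun t => c * f t) = c • E.borelCalc f :=
  E.borelCalc_eq fun x => by
    rw [smul_apply, inner_smul_right, E.inner_borelCalc hf,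
      integral_const_mul]

theorem adjoint_borelCalc (hf : IsBoundedBorel f) :
    ContinuousLinearMap.adjoint (E.borelCalc f) = E.borelCalc fun t => starRingEnd ℂ (f t) := by
  refine (E.borelCalc_eq fun x => ?_).symm
  rw [ContinuousLinearMap.adjoint_inner_right, ← inner_conj_symm, E.inner_borelCalc hf,
    integral_conj]

theorem tendsto_inner_borelCalc {F : ℕ → ℝ → ℂ} {C : ℝ} (hF : ∀ n, Measurable (F n))
    (hC : ∀ n t, ‖F n t‖ ≤ C) (h : ∀ t, Tendsto (fun n => F n t) atTop (𝓝 (f t)))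
    (hf : IsBoundedBorel f) (x y : K) :
    Tendsto (fun n => ⟪x, E.borelCalc (F n) y⟫_ℂ) atTop (𝓝 ⟪x, E.borelCalc f y⟫_ℂ) := by
  have hq : ∀ v, Tendsto (fun n => ⟪v, E.borelCalc (F n) v⟫_ℂ) atTop
      (𝓝 ⟪v, E.borelCalc f v⟫_ℂ) := by
    intro v
    rw [E.inner_borelCalc hf]
    simp_rw [fun n => E.inner_borelCalc (.of_bound (hF n) C (hC n)) v]
    exact E.tendsto_integral_scalar hF hC h v
  rw [clm_inner_polarization]
  simp_rw [fun n => clm_inner_polarization (E.borelCalc (F n)) x y]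
  exact (((((hq _).sub (hq _)).sub ((hq _).const_mul _)).add ((hq _).const_mul _)).div_const _)

/-! #### Multiplicativity -/

theorem adjoint_toFun {B : Set ℝ} (hB : MeasurableSet B) :
    ContinuousLinearMap.adjoint (E.toFun B) = E.toFun B := (E.nonneg B hB).isSelfAdjoint

theorem norm_toFun_sq (x : K) {B : Set ℝ} (hB : MeasurableSet B) :
    ‖E.toFun B x‖ ^ 2 = (E.scalar x).real B := by
  have h := E.inner_toFun x hB
  rw [← E.toFun_mul_self hB, mul_apply_eq_comp, ← ContinuousLinearMap.adjoint_inner_left,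
    E.adjoint_toFun hB, inner_self_eq_ofReal] at h
  exact Complex.ofReal_injective h

/-- The vector y = E(C)x has all its mass ‖y‖² on C, so nothing is left for B. -/
theorem toFun_mul_of_disjoint {B C : Set ℝ} (hB : MeasurableSet B) (hC : MeasurableSet C)
    (h : Disjoint B C) : E.toFun B * E.toFun C = 0 := by
  ext x
  have e : E.toFun C (E.toFun C x) = E.toFun C x := DFunLike.congr_fun (E.toFun_mul_self hC) x
  have h1 := E.norm_toFun_sq (E.toFun C x) hB
  have h2 := E.norm_toFun_sq (E.toFun C x) hC
  rw [e] at h2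
  have h3 : (E.scalar (E.toFun C x)).real (B ∪ C) ≤ (E.scalar (E.toFun C x)).real univ :=
    measureReal_mono (subset_univ _)
  rw [measureReal_union h hC, E.scalar_real_univ, ← h1, ← h2] at h3
  have h4 : ‖E.toFun B (E.toFun C x)‖ ^ 2 = 0 := le_antisymm (by linarith) (by positivity)
  simpa using h4

theorem toFun_mul {B C : Set ℝ} (hB : MeasurableSet B) (hC : MeasurableSet C) :
    E.toFun B * E.toFun C = E.toFun (B ∩ C) := by
  have e1 := E.toFun_union (hB.inter hC) (hB.diff hC) disjoint_inf_sdiff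
  have e2 := E.toFun_union (hC.inter hB) (hC.diff hB) disjoint_inf_sdiff
  rw [inter_union_sdiff] at e1 e2
  rw [e1, e2, inter_comm C B, add_mul, mul_add, mul_add, E.toFun_mul_self (hB.inter hC),
    E.toFun_mul_of_disjoint (hB.inter hC) (hC.diff hB), E.toFun_mul_of_disjoint (hB.diff hC)
    (hB.inter hC), E.toFun_mul_of_disjoint (hB.diff hC) (hC.diff hB)]
  · simp
  · exact disjoint_left.2 fun t h1 h2 => h1.2 h2.1
  · exact disjoint_left.2 fun t h1 h2 => h1.2 h2.2
  · exact disjoint_left.2 fun t h1 h2 => h2.2 h1.1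

theorem scalar_toFun (x : K) {B : Set ℝ} (hB : MeasurableSet B) :
    E.scalar (E.toFun B x) = (E.scalar x).restrict B := by
  refine E.measure_eq_scalar fun C hC => ?_
  rw [← ContinuousLinearMap.adjoint_inner_right, E.adjoint_toFun hB,
    measureReal_restrict_apply hC, ← E.inner_toFun x (hC.inter hB)]
  rw [← mul_apply_eq_comp, ← mul_apply_eq_comp,
    E.toFun_mul hB hC, E.toFun_mul (hB.inter hC) hB,
    show B ∩ C ∩ B = C ∩ B by ext t; simp; tauto]

/-- The reflection U = 2E(B) - 1 is unitary and commutes with every E(C), so x and Ux have the same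
scalar measure. As ∫ f dE is determined by these measures, conjugation by U fixes it. -/
theorem commute_toFun_borelCalc (hf : IsBoundedBorel f) {B : Set ℝ} (hB : MeasurableSet B) :
    E.toFun B * E.borelCalc f = E.borelCalc f * E.toFun B := by
  set P := E.toFun B
  set F := E.borelCalc f
  have hP : P * P = P := E.toFun_mul_self hB
  set U : K →L[ℂ] K := P + P - 1 with hU
  have hUU : U * U = 1 := by
    have : U * U = (P * P) + (P * P) + (P * P) + (P * P) - P - P - P - P + 1 := by
      rw [hU]; noncomm_ring
    rw [this, hP]; abel
  have hUa : ContinuousLinearMap.adjoint U = U := by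
    simp only [hU, map_sub, map_add, P, E.adjoint_toFun hB]
    rw [show ContinuousLinearMap.adjoint (1 : K →L[ℂ] K) = 1 from star_one _]
  have hin : ∀ (T : K →L[ℂ] K) x, ⟪U x, T (U x)⟫_ℂ = ⟪x, (U * T * U) x⟫_ℂ := fun T x => by
    rw [← ContinuousLinearMap.adjoint_inner_right, hUa]; rfl
  have hsc : ∀ x, E.scalar (U x) = E.scalar x := fun x => by
    refine E.measure_eq_scalar fun C hC => ?_
    have hc : U * E.toFun C = E.toFun C * U := by
      simp only [hU, sub_mul, add_mul, mul_sub, mul_add, P, E.toFun_mul hB hC,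
        E.toFun_mul hC hB, inter_comm B C, one_mul, mul_one]
    rw [hin, hc, mul_assoc, hUU, mul_one, E.inner_toFun x hC]
  have hUF : U * F * U = F := clm_ext_inner fun x => by
    rw [← hin, E.inner_borelCalc hf, E.inner_borelCalc hf, hsc]
  have hc : F * U = U * F := by
    calc F * U = (U * F * U) * U := by rw [hUF]
      _ = U * F * (U * U) := by noncomm_ring
      _ = U * F := by rw [hUU, mul_one]
  have h2 : (2 : ℂ) • (P * F) = (2 : ℂ) • (F * P) := by
    have e1 : F * U = (2 : ℂ) • (F * P) - F := by rw [hU, two_smul]; noncomm_ring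
    have e2 : U * F = (2 : ℂ) • (P * F) - F := by rw [hU, two_smul]; noncomm_ring
    rw [e1, e2] at hc
    exact (sub_left_injective hc).symm
  exact smul_right_injective _ (two_ne_zero : (2 : ℂ) ≠ 0) h2

theorem borelCalc_mul_toFun (hf : IsBoundedBorel f) {B : Set ℝ} (hB : MeasurableSet B) :
    E.borelCalc f * E.toFun B = E.borelCalc (B.indicator f) := by
  refine (E.borelCalc_eq fun x => ?_).symm
  rw [← E.toFun_mul_self hB, ← mul_assoc, ← E.commute_toFun_borelCalc hf hB,
    mul_apply_eq_comp, mul_apply_eq_comp,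
    ← ContinuousLinearMap.adjoint_inner_left, E.adjoint_toFun hB, E.inner_borelCalc hf,
    E.scalar_toFun x hB, integral_indicator hB]

theorem borelCalc_mul_simpleFunc (hf : IsBoundedBorel f) (s : SimpleFunc ℝ ℂ) :
    E.borelCalc f * E.borelCalc s = E.borelCalc fun t => f t * s t := by
  induction s using SimpleFunc.induction with
  | const c hs =>
    rename_i B
    have e : ∀ t, (SimpleFunc.piecewise B hs (SimpleFunc.const ℝ c) (SimpleFunc.const ℝ 0)) t
        = c * B.indicator (fun _ => 1) t := by
      intro t; by_cases h : t ∈ B <;> simp [h]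
    rw [funext e, E.borelCalc_smul c ((IsBoundedBorel.const 1).indicator hs),
      E.borelCalc_indicator_one hs, mul_smul_comm, E.borelCalc_mul_toFun hf hs,
      ← E.borelCalc_smul c (hf.indicator hs)]
    congr 1; ext t
    by_cases h : t ∈ B <;> simp [h, mul_comm]
  | add _ h1 h2 =>
    rename_i s1 s2 _
    have b1 := IsBoundedBorel.simpleFunc s1
    have b2 := IsBoundedBorel.simpleFunc s2
    simp only [SimpleFunc.coe_add, Pi.add_apply, mul_add]
    rw [E.borelCalc_add (hf.mul b1) (hf.mul b2), ← h1, ← h2, ← mul_add]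
    congr 1
    exact E.borelCalc_add b1 b2

/-- Uniformly bounded simple functions converging pointwise to g reduce this to simple g, since both
sides pass to weak limits. -/
theorem borelCalc_mul (hf : IsBoundedBorel f) (hg : IsBoundedBorel g) :
    E.borelCalc f * E.borelCalc g = E.borelCalc fun t => f t * g t := by
  have hg' := hg
  have hfg := hf.mul hg
  obtain ⟨hg, C, hC⟩ := hg
  obtain ⟨hfm, D, hD⟩ := id hf
  let s : ℕ → SimpleFunc ℝ ℂ := SimpleFunc.approxOn g hg univ 0 (mem_univ _)
  have hs : ∀ n t, ‖s n t‖ ≤ C + C := fun n t =>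
    (SimpleFunc.norm_approxOn_zero_le hg (mem_univ _) t n).trans (add_le_add (hC t) (hC t))
  have hlim : ∀ t, Tendsto (fun n => s n t) atTop (𝓝 (g t)) :=
    fun t => SimpleFunc.tendsto_approxOn hg _ (by simp)
  ext y
  refine ext_inner_left ℂ fun x => ?_
  have h1 := E.tendsto_inner_borelCalc (fun n => (s n).measurable) hs hlim hg'
    (ContinuousLinearMap.adjoint (E.borelCalc f) x) y
  have h2 := E.tendsto_inner_borelCalc (F := fun n t => f t * s n t) (C := D * (C + C))
    (fun n => hfm.mul (s n).measurable)
    (fun n t => by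
      rw [norm_mul]
      exact mul_le_mul (hD t) (hs n t) (norm_nonneg _) ((norm_nonneg _).trans (hD t)))
    (fun t => (hlim t).const_mul _) hfg x y
  simp_rw [← E.borelCalc_mul_simpleFunc hf, mul_apply_eq_comp,
    ← ContinuousLinearMap.adjoint_inner_left (E.borelCalc f)] at h2
  rw [mul_apply_eq_comp, ← ContinuousLinearMap.adjoint_inner_left (E.borelCalc f)]
  exact tendsto_nhds_unique h1 h2

theorem norm_borelCalc_sq (hf : IsBoundedBorel f) (x : K) :
    ‖E.borelCalc f x‖ ^ 2 = ∫ t, ‖f t‖ ^ 2 ∂E.scalar x := by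
  have h : ⟪E.borelCalc f x, E.borelCalc f x⟫_ℂ = ∫ t, ((‖f t‖ ^ 2 : ℝ) : ℂ) ∂E.scalar x := by
    rw [← ContinuousLinearMap.adjoint_inner_right, E.adjoint_borelCalc hf,
      ← mul_apply_eq_comp, E.borelCalc_mul hf.conj hf,
      E.inner_borelCalc (hf.conj.mul hf)]
    congr 1; ext t
    rw [mul_comm, Complex.mul_conj, Complex.normSq_eq_norm_sq]
  rw [inner_self_eq_ofReal] at h
  exact Complex.ofReal_injective (h.trans integral_ofReal)

/-- Convergence is strong, not just weak: ‖∫ (Fₙ - f) dE x‖² is the integral of |Fₙ - f|², to which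
dominated convergence applies. -/
theorem tendsto_borelCalc {F : ℕ → ℝ → ℂ} {C : ℝ} (hF : ∀ n, Measurable (F n))
    (hC : ∀ n t, ‖F n t‖ ≤ C) (h : ∀ t, Tendsto (fun n => F n t) atTop (𝓝 (f t)))
    (hf : IsBoundedBorel f) (x : K) :
    Tendsto (fun n => E.borelCalc (F n) x) atTop (𝓝 (E.borelCalc f x)) := by
  rw [tendsto_iff_norm_sub_tendsto_zero]
  have hFn : ∀ n, IsBoundedBorel (F n) := fun n => .of_bound (hF n) C (hC n)
  obtain ⟨hfm, D, hD⟩ := id hf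
  have hsq : Tendsto (fun n => ‖E.borelCalc (F n) x - E.borelCalc f x‖ ^ 2) atTop (𝓝 0) := by
    simp_rw [← sub_apply, fun n => (E.borelCalc_sub (hFn n) hf).symm,
      fun n => E.norm_borelCalc_sq ((hFn n).sub hf) x]
    have := tendsto_integral_of_dominated_convergence (μ := E.scalar x)
      (F := fun n t => ‖F n t - f t‖ ^ 2) (f := fun _ => (0 : ℝ)) (fun _ => (C + D) ^ 2)
      (fun n => (((hF n).sub hfm).norm.pow_const 2).aestronglyMeasurable) (integrable_const _)
      (fun n => ae_of_all _ fun t => by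
        rw [norm_pow, norm_norm]
        gcongr
        exact (norm_sub_le _ _).trans (add_le_add (hC n t) (hD t)))
      (ae_of_all _ fun t => by
        simpa using ((tendsto_iff_norm_sub_tendsto_zero.1 (h t)).pow 2))
    simpa using this
  have := hsq.sqrt
  simpa using this

theorem scalar_borelCalc (hf : IsBoundedBorel f) (x : K) :
    E.scalar (E.borelCalc f x) =
      (E.scalar x).withDensity fun t => ENNReal.ofReal (‖f t‖ ^ 2) := by
  ext B hB
  have hi : Integrable (fun t => ‖(B.indicator f) t‖ ^ 2) (E.scalar x) := by
    have := (((hf.indicator hB).conj.mul (hf.indicator hB)).integrable (E.scalar x)).norm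
    refine this.congr (ae_of_all _ fun t => ?_)
    simp [sq]
  have h := E.norm_toFun_sq (E.borelCalc f x) hB
  rw [← mul_apply_eq_comp, E.commute_toFun_borelCalc hf hB,
    E.borelCalc_mul_toFun hf hB, E.norm_borelCalc_sq (hf.indicator hB)] at h
  rw [withDensity_apply _ hB, ← ENNReal.ofReal_toReal (measure_ne_top (E.scalar _) B),
    ← measureReal_def, ← h, ofReal_integral_eq_lintegral_ofReal hi
    (ae_of_all _ fun t => by positivity), ← lintegral_indicator hB]
  congr 1; ext t
  by_cases ht : t ∈ B <;> simp [ht]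

theorem isPositive_borelCalc {f : ℝ → ℝ} (hf : IsBoundedBorel fun t => (f t : ℂ))
    (h : ∀ t, 0 ≤ f t) : (E.borelCalc fun t => (f t : ℂ)).IsPositive := by
  rw [ContinuousLinearMap.isPositive_iff_complex]
  intro x
  have h1 : ⟪E.borelCalc (fun t => (f t : ℂ)) x, x⟫_ℂ = ((∫ t, f t ∂E.scalar x : ℝ) : ℂ) := by
    rw [← inner_conj_symm, E.inner_borelCalc hf]
    exact (congrArg _ integral_ofReal).trans (Complex.conj_ofReal _)
  rw [h1]
  refine ⟨by simp, ?_⟩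
  rw [RCLike.re_eq_complex_re, Complex.ofReal_re]
  exact integral_nonneg h

end SpectralMeasure

/-! ### Symmetric operators and their resolvents -/

section Resolvents

variable {K : Type*} [NormedAddCommGroup K] [InnerProductSpace ℂ K] {A : K →ₗ.[ℂ] K} {z : ℂ}

theorem IsResolventAt.unique {R R' : K →L[ℂ] K} (h : IsResolventAt A z R)
    (h' : IsResolventAt A z R') : R = R' := by
  ext x
  obtain ⟨hx, e⟩ := h'.1 x
  have h2 := h.2 ⟨R' x, hx⟩
  rwa [e] at h2

theorem IsResolventAt.resolventOp_eq {R : K →L[ℂ] K} (h : IsResolventAt A z R) :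
    resolventOp A z = R := by
  have h' : ∃ R : K →L[ℂ] K, IsResolventAt A z R := ⟨R, h⟩
  rw [resolventOp, dif_pos h']
  exact h'.choose_spec.unique h

/-- First resolvent identity. -/
theorem IsResolventAt.sub_eq {w : ℂ} {R R' : K →L[ℂ] K}
    (hR : IsResolventAt A z R) (hR' : IsResolventAt A w R') :
    R - R' = (z - w) • (R * R') := by
  ext x
  obtain ⟨hx, ex⟩ := hR'.1 x
  have h := hR.2 ⟨R' x, hx⟩
  have e : A ⟨R' x, hx⟩ - z • R' x = x - (z - w) • R' x := by
    rw [sub_smul]; nth_rw 3 [← ex]; abel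
  simp only [e, map_sub, map_smul] at h
  change R x - R' x = (z - w) • R (R' x)
  rw [sub_eq_iff_eq_add] at h ⊢
  rw [h, add_comm]

/-- For symmetric A the number (x, Ax) is real, so Im (x, (A - z)x) = -Im z ‖x‖². This yields
injectivity of A - z off the real axis, closedness of its range, and the resolvent bound. -/
theorem IsFormalAdjoint.abs_im_mul_norm_le (hA : A.IsFormalAdjoint A) (z : ℂ) (x : A.domain) :
    |z.im| * ‖(x : K)‖ ≤ ‖A x - z • (x : K)‖ := by
  have hreal : (⟪(x : K), A x⟫_ℂ).im = 0 := by
    rw [← Complex.conj_eq_iff_im, inner_conj_symm]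
    exact hA x x
  have h1 : (⟪(x : K), A x - z • (x : K)⟫_ℂ).im = -z.im * ‖(x : K)‖ ^ 2 := by
    rw [inner_sub_right, inner_smul_right, inner_self_eq_ofReal, Complex.sub_im, hreal,
      Complex.im_mul_ofReal]
    ring
  have h2 : |z.im| * ‖(x : K)‖ ^ 2 ≤ ‖(x : K)‖ * ‖A x - z • (x : K)‖ := by
    calc |z.im| * ‖(x : K)‖ ^ 2 = |(⟪(x : K), A x - z • (x : K)⟫_ℂ).im| := by
          rw [h1, abs_mul, abs_neg, abs_of_nonneg (sq_nonneg ‖(x : K)‖)]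
      _ ≤ ‖⟪(x : K), A x - z • (x : K)⟫_ℂ‖ := Complex.abs_im_le_norm _
      _ ≤ _ := norm_inner_le_norm _ _
  rcases (norm_nonneg (x : K)).eq_or_lt with h0 | h0
  · rw [← h0]; simp
  · refine le_of_mul_le_mul_left ?_ h0
    linarith

/-- A right inverse suffices, because A - z is injective for nonreal z. -/
theorem IsFormalAdjoint.isResolventAt (hA : A.IsFormalAdjoint A) (hz : z.im ≠ 0) {R : K →L[ℂ] K}
    (hR : ∀ x, ∃ hx : R x ∈ A.domain, A ⟨R x, hx⟩ - z • R x = x) : IsResolventAt A z R := by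
  refine ⟨hR, fun x => ?_⟩
  obtain ⟨hy, e⟩ := hR (A x - z • (x : K))
  have h := abs_im_mul_norm_le hA z (⟨R (A x - z • (x : K)), hy⟩ - x)
  rw [LinearPMap.map_sub, AddSubgroupClass.coe_sub, smul_sub, sub_sub_sub_comm, e, sub_self,
    norm_zero] at h
  have h2 : 0 < |z.im| := abs_pos.2 hz
  have h3 := nonpos_of_mul_nonpos_right h h2
  exact sub_eq_zero.1 (norm_le_zero_iff.1 h3)

theorem isFormalAdjoint_of_isSelfAdjoint [CompleteSpace K] (hA : IsSelfAdjoint A) :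
    A.IsFormalAdjoint A := by
  have h := LinearPMap.adjoint_isFormalAdjoint (T := A) hA.dense_domain
  rwa [LinearPMap.isSelfAdjoint_def.1 hA] at h

end Resolvents

/-! ### Resolvents from spectral measures -/

/-- The function `t ↦ 1 / (t - z)`. -/
noncomputable def cauchyKernel (z : ℂ) (t : ℝ) : ℂ := 1 / ((t : ℂ) - z)

section CauchyKernel

variable {z : ℂ}

theorem ofReal_sub_ne_zero (hz : z.im ≠ 0) (t : ℝ) : (t : ℂ) - z ≠ 0 := by
  intro h
  apply hz
  have := congrArg Complex.im h
  simpa using this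

theorem measurable_cauchyKernel (z : ℂ) : Measurable (cauchyKernel z) := by
  unfold cauchyKernel
  fun_prop

theorem norm_cauchyKernel_le (hz : z.im ≠ 0) (t : ℝ) : ‖cauchyKernel z t‖ ≤ |z.im|⁻¹ := by
  rw [cauchyKernel, norm_div, norm_one, one_div]
  refine inv_anti₀ (abs_pos.2 hz) ?_
  have := Complex.abs_im_le_norm ((t : ℂ) - z)
  simpa using this

theorem isBoundedBorel_cauchyKernel (hz : z.im ≠ 0) : IsBoundedBorel (cauchyKernel z) :=
  ⟨measurable_cauchyKernel z, _, norm_cauchyKernel_le hz⟩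

theorem isBoundedBorel_mul_cauchyKernel (hz : z.im ≠ 0) :
    IsBoundedBorel fun t => (t : ℂ) * cauchyKernel z t := by
  have h := (IsBoundedBorel.const 1).add ((IsBoundedBorel.const z).mul (isBoundedBorel_cauchyKernel hz))
  convert h using 2 with t
  rw [cauchyKernel]
  field_simp [ofReal_sub_ne_zero hz t]
  ring

theorem isBoundedBorel_indicator_of_continuous {f : ℝ → ℂ} (hf : Continuous f) {B : Set ℝ}
    (hB : MeasurableSet B) (hb : Bornology.IsBounded B) : IsBoundedBorel (B.indicator f) := by
  obtain ⟨C, hC⟩ := (hb.isCompact_closure.image hf).isBounded.exists_norm_le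
  refine ⟨hf.measurable.indicator hB, max C 0, fun t => ?_⟩
  by_cases h : t ∈ B
  · rw [indicator_of_mem h]
    exact (hC _ ⟨t, subset_closure h, rfl⟩).trans (le_max_left _ _)
  · simp [h]

end CauchyKernel

namespace SpectralMeasure

variable {K : Type*} [NormedAddCommGroup K] [InnerProductSpace ℂ K]
  (E : SpectralMeasure K) {A : K →ₗ.[ℂ] K} {z : ℂ}

variable [CompleteSpace K]

theorem tendsto_toFun {B : ℕ → Set ℝ} (hB : ∀ n, MeasurableSet (B n)) (hmono : Monotone B)
    (hU : ⋃ n, B n = univ) (x : K) :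
    Tendsto (fun n => E.toFun (B n) x) atTop (𝓝 x) := by
  simp_rw [fun n => (E.borelCalc_indicator_one (hB n)).symm]
  have := E.tendsto_borelCalc (F := fun n => (B n).indicator fun _ => 1) (C := 1)
    (f := fun _ => 1) (fun n => measurable_const.indicator (hB n))
    (fun n t => (norm_indicator_le_norm_self _ _).trans (by simp))
    (fun t => by
      obtain ⟨m, hm⟩ := mem_iUnion.1 (hU ▸ mem_univ t : t ∈ ⋃ n, B n)
      refine tendsto_const_nhds.congr' ?_
      filter_upwards [eventually_ge_atTop m] with n hn
      rw [indicator_of_mem (hmono hn hm)])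
    (.const 1) x
  rwa [E.borelCalc_one] at this

theorem tendsto_toFun_Icc (x : K) :
    Tendsto (fun n : ℕ => E.toFun (Icc (-(n : ℝ)) n) x) atTop (𝓝 x) := by
  refine E.tendsto_toFun (fun n => measurableSet_Icc) (fun m n h => ?_) ?_ x
  · have : (m : ℝ) ≤ n := by exact_mod_cast h
    exact Icc_subset_Icc (neg_le_neg this) this
  · refine eq_univ_of_forall fun t => ?_
    obtain ⟨n, hn⟩ := exists_nat_ge |t|
    exact mem_iUnion.2 ⟨n, abs_le.1 hn⟩

/-- Places the range of E(B), for bounded B, inside the range of ∫ (t - z)⁻¹ dE; the latter is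
therefore dense. -/
theorem borelCalc_cauchyKernel_mul_indicator (hz : z.im ≠ 0) {B : Set ℝ} (hB : MeasurableSet B)
    (hb : Bornology.IsBounded B) :
    E.borelCalc (cauchyKernel z) * E.borelCalc (B.indicator fun t => (t : ℂ) - z) = E.toFun B := by
  rw [E.borelCalc_mul (isBoundedBorel_cauchyKernel hz)
    (isBoundedBorel_indicator_of_continuous (by fun_prop) hB hb), ← E.borelCalc_indicator_one hB]
  congr 1; ext t
  by_cases h : t ∈ B
  · simp [h, cauchyKernel, ofReal_sub_ne_zero hz t]
  · simp [h]

theorem lintegral_sq_borelCalc_cauchyKernel_lt_top (hz : z.im ≠ 0) (u : K) :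
    ∫⁻ t, ENNReal.ofReal (t ^ 2) ∂E.scalar (E.borelCalc (cauchyKernel z) u) < ∞ := by
  obtain ⟨-, C, hC⟩ := isBoundedBorel_mul_cauchyKernel hz
  rw [E.scalar_borelCalc (isBoundedBorel_cauchyKernel hz),
    lintegral_withDensity_eq_lintegral_mul _
      (((measurable_cauchyKernel z).norm.pow_const 2).ennreal_ofReal) (by fun_prop)]
  calc _ ≤ ∫⁻ _, ENNReal.ofReal (C ^ 2) ∂E.scalar u := by
        refine lintegral_mono fun t => ?_
        rw [Pi.mul_apply, ← ENNReal.ofReal_mul (by positivity)]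
        refine ENNReal.ofReal_le_ofReal ?_
        have := pow_le_pow_left₀ (norm_nonneg _) (hC t) 2
        rw [norm_mul, mul_pow, Complex.norm_real, Real.norm_eq_abs, sq_abs] at this
        linarith
    _ < ∞ := by
        rw [lintegral_const]
        exact ENNReal.mul_lt_top ENNReal.ofReal_lt_top (measure_lt_top _ _)

theorem inner_borelCalc_cauchyKernel (hz : z.im ≠ 0) (u : K) :
    ⟪E.borelCalc (cauchyKernel z) u, E.borelCalc (fun t => (t : ℂ) * cauchyKernel z t) u⟫_ℂ =
      ((∫ t, t ∂E.scalar (E.borelCalc (cauchyKernel z) u) : ℝ) : ℂ) := by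
  have hc := isBoundedBorel_cauchyKernel hz
  have hm := isBoundedBorel_mul_cauchyKernel hz
  rw [← ContinuousLinearMap.adjoint_inner_right, E.adjoint_borelCalc hc, ← mul_apply_eq_comp,
    E.borelCalc_mul hc.conj hm, E.inner_borelCalc (hc.conj.mul hm), E.scalar_borelCalc hc,
    integral_withDensity_eq_integral_toReal_smul
      (((measurable_cauchyKernel z).norm.pow_const 2).ennreal_ofReal) (by simp)]
  refine Eq.trans ?_ integral_ofReal
  congr 1; ext t
  rw [ENNReal.toReal_ofReal (by positivity), smul_eq_mul]
  change _ = ((‖cauchyKernel z t‖ ^ 2 * t : ℝ) : ℂ)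
  rw [Complex.ofReal_mul, ← Complex.normSq_eq_norm_sq, ← Complex.mul_conj]
  ring

variable {E}

/-- With R = ∫ (t - z)⁻¹ dE, the lower bound on |t - z| growing like |t| puts Ru into dom A. Only
the quadratic form of A is given, so AR = ∫ t (t - z)⁻¹ dE is obtained by polarization against
vectors Ru and then from the density of the range of R. Hence (A - z)R = 1. -/
theorem IsSpectralMeasureOf.isResolventAt (hE : E.IsSpectralMeasureOf A)
    (hA : A.IsFormalAdjoint A) (hz : z.im ≠ 0) :
    IsResolventAt A z (E.borelCalc (cauchyKernel z)) := by
  have hc := isBoundedBorel_cauchyKernel hz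
  have hm := isBoundedBorel_mul_cauchyKernel hz
  set R := E.borelCalc (cauchyKernel z) with hR
  have hdom : ∀ u, R u ∈ A.domain := fun u =>
    (hE.mem_domain_iff _).2 (E.lintegral_sq_borelCalc_cauchyKernel_lt_top hz u)
  let T : K →ₗ[ℂ] K := A.toFun.comp (R.toLinearMap.codRestrict A.domain hdom)
  have hT : ∀ u, T u = A ⟨R u, hdom u⟩ := fun _ => rfl
  have key : ∀ u v, ⟪R u, T v⟫_ℂ = ⟪R u, E.borelCalc (fun t => (t : ℂ) * cauchyKernel z t) v⟫_ℂ :=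
    inner_eq_of_forall_inner_self (S := R.toLinearMap)
      (T' := (E.borelCalc (fun t => (t : ℂ) * cauchyKernel z t)).toLinearMap) fun v =>
        (hE.inner_apply ⟨R v, hdom v⟩).trans (E.inner_borelCalc_cauchyKernel hz v).symm
  have hTeq : ∀ v, T v = E.borelCalc (fun t => (t : ℂ) * cauchyKernel z t) v := by
    intro v
    refine ext_inner_left ℂ fun w => ?_
    -- Density: w is the limit of the vectors E([-n, n])w, which lie in the range of R, where `key`
    -- applies.
    have hlim := fun a : K => (E.tendsto_toFun_Icc w).inner (𝕜 := ℂ) (tendsto_const_nhds (x := a))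
    refine tendsto_nhds_unique (hlim _) ((hlim _).congr fun n => ?_)
    rw [← E.borelCalc_cauchyKernel_mul_indicator hz measurableSet_Icc (Metric.isBounded_Icc _ _),
      mul_apply_eq_comp, key]
  refine IsFormalAdjoint.isResolventAt hA hz fun x => ⟨hdom x, ?_⟩
  rw [← hT, hTeq, hR, ← smul_apply, ← sub_apply, ← E.borelCalc_smul z hc,
    ← E.borelCalc_sub hm ((IsBoundedBorel.const z).mul hc)]
  have : (fun t : ℝ => (t : ℂ) * cauchyKernel z t - z * cauchyKernel z t) = fun _ => 1 := by
    ext t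
    rw [← sub_mul, cauchyKernel, mul_one_div_cancel (ofReal_sub_ne_zero hz t)]
  rw [this, E.borelCalc_one]
  rfl

/-- One nonreal point suffices, since dom A is the range of the resolvent. Conversely let C = ∫ t²
d(x, Ex) be finite and Aₙ = ∫ t dE over [-n, n]. Then (x, E([-n, n])Av) = (Aₙx, v) and ‖Aₙx‖ ≤ √C,
so v ↦ (x, Av) is bounded and x lies in dom A* = dom A. -/
theorem isSpectralMeasureOf_of_isResolventAt (hA : IsSelfAdjoint A) (hz : z.im ≠ 0)
    (hR : IsResolventAt A z (E.borelCalc (cauchyKernel z))) : E.IsSpectralMeasureOf A := by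
  have hc := isBoundedBorel_cauchyKernel hz
  have hm := isBoundedBorel_mul_cauchyKernel hz
  have hAR : ∀ u, A ⟨E.borelCalc (cauchyKernel z) u, (hR.1 u).1⟩ =
      E.borelCalc (fun t => (t : ℂ) * cauchyKernel z t) u := by
    intro u
    have e : (fun t : ℝ => (t : ℂ) * cauchyKernel z t) = fun t => 1 + z * cauchyKernel z t := by
      ext t
      rw [cauchyKernel]
      field_simp [ofReal_sub_ne_zero hz t]
      ring
    rw [e, E.borelCalc_add (.const 1) ((IsBoundedBorel.const z).mul hc), E.borelCalc_one,
      E.borelCalc_smul z hc, add_apply, one_apply_eq_self, smul_apply]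
    exact sub_eq_iff_eq_add.1 (hR.1 u).2
  have hdom : ∀ x : A.domain, ∃ u, (x : K) = E.borelCalc (cauchyKernel z) u := fun x =>
    ⟨_, (hR.2 x).symm⟩
  refine ⟨fun x => ⟨fun hx => ?_, fun hx => ?_⟩, fun x => ?_⟩
  · obtain ⟨u, hu⟩ := hdom ⟨x, hx⟩
    rw [show x = _ from hu]
    exact E.lintegral_sq_borelCalc_cauchyKernel_lt_top hz u
  · rw [← LinearPMap.isSelfAdjoint_def.1 hA, LinearPMap.mem_adjoint_domain_iff]
    set C := (∫⁻ t, ENNReal.ofReal (t ^ 2) ∂E.scalar x).toReal with hCdef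
    have hn : ∀ n : ℕ, ‖E.borelCalc ((Icc (-(n : ℝ)) n).indicator fun t => (t : ℂ)) x‖ ≤ √C := by
      intro n
      have hb : IsBoundedBorel ((Icc (-(n : ℝ)) n).indicator fun t => (t : ℂ)) :=
        isBoundedBorel_indicator_of_continuous (by fun_prop) measurableSet_Icc
          (Metric.isBounded_Icc _ _)
      refine Real.le_sqrt_of_sq_le ?_
      rw [E.norm_borelCalc_sq hb, integral_eq_lintegral_of_nonneg_ae
        (ae_of_all _ fun t => by positivity) (hb.1.norm.pow_const 2).aestronglyMeasurable]
      refine ENNReal.toReal_mono hx.ne (lintegral_mono fun t => ENNReal.ofReal_le_ofReal ?_)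
      have := pow_le_pow_left₀ (norm_nonneg _)
        (norm_indicator_le_norm_self (s := Icc (-(n : ℝ)) n) (fun t : ℝ => (t : ℂ)) t) 2
      simpa using this
    refine AddMonoidHomClass.continuous_of_bound _ (√C) fun v => ?_
    obtain ⟨u, hu⟩ := hdom v
    have hAv : A v = E.borelCalc (fun t => (t : ℂ) * cauchyKernel z t) u := by
      rw [← hAR]; congr 1; exact Subtype.ext hu
    change ‖⟪x, A v⟫_ℂ‖ ≤ √C * ‖(v : K)‖
    have hlim := ((E.tendsto_toFun_Icc (A v)).inner (𝕜 := ℂ) (tendsto_const_nhds (x := x))).norm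
    rw [norm_inner_symm]
    refine le_of_tendsto hlim (Eventually.of_forall fun n => ?_)
    have hb : IsBoundedBorel ((Icc (-(n : ℝ)) n).indicator fun t => (t : ℂ)) :=
      isBoundedBorel_indicator_of_continuous (by fun_prop) measurableSet_Icc
        (Metric.isBounded_Icc _ _)
    have e : E.toFun (Icc (-(n : ℝ)) n) (A v) =
        E.borelCalc ((Icc (-(n : ℝ)) n).indicator fun t => (t : ℂ)) v := by
      rw [hAv, hu, ← mul_apply_eq_comp, ← mul_apply_eq_comp,
        E.commute_toFun_borelCalc hm measurableSet_Icc, E.borelCalc_mul_toFun hm measurableSet_Icc,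
        E.borelCalc_mul hb hc]
      congr 2; ext t
      by_cases h : t ∈ Icc (-(n : ℝ)) n <;> simp [h]
    have hconj : ContinuousLinearMap.adjoint
        (E.borelCalc ((Icc (-(n : ℝ)) n).indicator fun t => (t : ℂ))) =
        E.borelCalc ((Icc (-(n : ℝ)) n).indicator fun t => (t : ℂ)) := by
      rw [E.adjoint_borelCalc hb]
      congr 1; ext t
      by_cases h : t ∈ Icc (-(n : ℝ)) n <;> simp [h]
    rw [e, ← ContinuousLinearMap.adjoint_inner_right, hconj, mul_comm]
    exact (norm_inner_le_norm _ _).trans (mul_le_mul_of_nonneg_left (hn n) (norm_nonneg _))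
  · obtain ⟨u, hu⟩ := hdom x
    have hx : x = ⟨E.borelCalc (cauchyKernel z) u, (hR.1 u).1⟩ := Subtype.ext hu
    rw [hx, hAR]
    exact E.inner_borelCalc_cauchyKernel hz u

end SpectralMeasure

/-! ### Resolvents of self-adjoint operators -/

section SelfAdjointResolvent

variable {K : Type*} [NormedAddCommGroup K] [InnerProductSpace ℂ K] [CompleteSpace K]
  {A : K →ₗ.[ℂ] K}

/-- On the complete space given by the graph of A, the map A - z is bounded and bounded below, so
its range is closed. A vector orthogonal to the range lies in ker(A* - z̄) = ker(A - z̄), which is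
zero. -/
theorem exists_isResolventAt (hA : IsSelfAdjoint A) {z : ℂ} (hz : z.im ≠ 0) :
    ∃ R : K →L[ℂ] K, IsResolventAt A z R := by
  have hs := isFormalAdjoint_of_isSelfAdjoint hA
  have : CompleteSpace A.graph := IsClosed.completeSpace_coe (hs := hA.isClosed)
  have hzpos : 0 < |z.im| := abs_pos.2 hz
  let g : A.graph →L[ℂ] K :=
    (ContinuousLinearMap.snd ℂ K K - z • ContinuousLinearMap.fst ℂ K K) ∘L A.graph.subtypeL
  have hg : ∀ p : A.graph, g p = (p : K × K).2 - z • (p : K × K).1 := fun p => rfl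
  have hbound : ∀ p : A.graph, |z.im| * ‖(p : K × K).1‖ ≤ ‖g p‖ := by
    rintro ⟨⟨a, b⟩, hp⟩
    obtain ⟨x, hx, hb⟩ := (LinearPMap.mem_graph_iff A).1 hp
    simp only at hx hb
    rw [hg]
    simpa [← hx, ← hb] using IsFormalAdjoint.abs_im_mul_norm_le hs z x
  have hanti : AntilipschitzWith (Real.toNNReal (1 + (1 + ‖z‖) / |z.im|)) g := by
    refine AddMonoidHomClass.antilipschitz_of_bound g fun p => ?_
    rw [Real.coe_toNNReal _ (by positivity)]
    have h1 : ‖(p : K × K).1‖ ≤ ‖g p‖ / |z.im| := by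
      rw [le_div_iff₀ hzpos, mul_comm]; exact hbound p
    have h2 : ‖(p : K × K).2‖ ≤ ‖g p‖ + ‖z‖ * ‖(p : K × K).1‖ := by
      calc ‖(p : K × K).2‖ = ‖g p + z • (p : K × K).1‖ := by rw [hg, sub_add_cancel]
        _ ≤ _ := (norm_add_le _ _).trans (by rw [norm_smul])
    have h3 : ‖z‖ * ‖(p : K × K).1‖ ≤ ‖z‖ * (‖g p‖ / |z.im|) := by gcongr
    have h4 : 0 ≤ ‖z‖ * (‖g p‖ / |z.im|) := by positivity
    have e : (1 + (1 + ‖z‖) / |z.im|) * ‖g p‖ =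
      ‖g p‖ + ‖g p‖ / |z.im| + ‖z‖ * (‖g p‖ / |z.im|) := by ring
    have h5 : 0 ≤ ‖g p‖ / |z.im| := by positivity
    rw [e, Submodule.coe_norm, Prod.norm_def]
    exact max_le (by linarith [norm_nonneg (g p)]) (by linarith)
  have hker : (g : A.graph →ₗ[ℂ] K).ker = ⊥ := LinearMap.ker_eq_bot.2 hanti.injective
  have hclosed : IsClosed ((g : A.graph →ₗ[ℂ] K).range : Set K) := by
    rw [LinearMap.coe_range]
    exact hanti.isClosed_range g.uniformContinuous
  have hrange : (g : A.graph →ₗ[ℂ] K).range = ⊤ := by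
    rw [← hclosed.submodule_topologicalClosure_eq, Submodule.topologicalClosure_eq_top_iff,
      Submodule.eq_bot_iff]
    intro w hw
    have hw' : ∀ x : A.domain, ⟪(starRingEnd ℂ z) • w, (x : K)⟫_ℂ = ⟪w, A x⟫_ℂ := by
      intro x
      have h := Submodule.inner_left_of_mem_orthogonal
        (LinearMap.mem_range_self (g : A.graph →ₗ[ℂ] K) ⟨_, A.mem_graph x⟩) hw
      change ⟪w, A x - z • (x : K)⟫_ℂ = 0 at h
      rw [inner_sub_right, inner_smul_right, sub_eq_zero] at h
      rw [inner_smul_left, Complex.conj_conj, h]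
    have hmem := LinearPMap.mem_adjoint_domain_of_exists (T := A) w ⟨_, hw'⟩
    have hap := LinearPMap.adjoint_apply_eq hA.dense_domain ⟨w, hmem⟩ hw'
    have hex : ∃ h : w ∈ A.adjoint.domain, A.adjoint ⟨w, h⟩ = (starRingEnd ℂ z) • w :=
      ⟨hmem, hap⟩
    rw [LinearPMap.isSelfAdjoint_def.1 hA] at hex
    obtain ⟨h, e⟩ := hex
    have hb := IsFormalAdjoint.abs_im_mul_norm_le hs (starRingEnd ℂ z) ⟨w, h⟩
    rw [e, sub_self, norm_zero, Complex.conj_im, abs_neg] at hb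
    exact norm_le_zero_iff.1 (nonpos_of_mul_nonpos_right hb hzpos)
  let G := ContinuousLinearEquiv.ofBijective g hker hrange
  refine ⟨ContinuousLinearMap.fst ℂ K K ∘L A.graph.subtypeL ∘L G.symm.toContinuousLinearMap,
    IsFormalAdjoint.isResolventAt hs hz fun x => ?_⟩
  obtain ⟨y, hy1, hy2⟩ := (LinearPMap.mem_graph_iff A).1 (G.symm x).2
  have hGx : g (G.symm x) = x := G.apply_symm_apply x
  rw [hg] at hGx
  refine ⟨by change ((G.symm x : K × K)).1 ∈ _; rw [← hy1]; exact y.2, ?_⟩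
  have : (⟨(G.symm x : K × K).1, by rw [← hy1]; exact y.2⟩ : A.domain) = y := Subtype.ext hy1.symm
  change A ⟨(G.symm x : K × K).1, _⟩ - z • (G.symm x : K × K).1 = x
  rw [this, hy2, hGx]

theorem IsResolventAt.adjoint_eq (hs : A.IsFormalAdjoint A) {z : ℂ} {R R' : K →L[ℂ] K}
    (hR : IsResolventAt A z R) (hR' : IsResolventAt A (starRingEnd ℂ z) R') :
    ContinuousLinearMap.adjoint R = R' := by
  ext y
  refine ext_inner_left ℂ fun x => ?_
  obtain ⟨hx, ex⟩ := hR.1 x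
  obtain ⟨hy, ey⟩ := hR'.1 y
  have h := hs ⟨R x, hx⟩ ⟨R' y, hy⟩
  rw [ContinuousLinearMap.adjoint_inner_right]
  nth_rw 1 [← ey]
  nth_rw 2 [← ex]
  rw [inner_sub_right, inner_sub_left, inner_smul_left, inner_smul_right, ← h]

end SelfAdjointResolvent

/-! ### Existence of spectral measures -/

section Construction

variable {K : Type*} [NormedAddCommGroup K] [InnerProductSpace ℂ K]

/-! ### Idempotents as weak limits -/

section Projections

variable [CompleteSpace K]

theorem adjoint_eq_of_inner_real {T : K →L[ℂ] K} {q : K → ℝ}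
    (h : ∀ x, ⟪x, T x⟫_ℂ = (q x : ℂ)) : ContinuousLinearMap.adjoint T = T :=
  clm_ext_inner fun x => by
    rw [ContinuousLinearMap.adjoint_inner_right, ← inner_conj_symm, h, Complex.conj_ofReal]

theorem mul_self_of_norm_sq {T : K →L[ℂ] K} {q : K → ℝ} (h : ∀ x, ⟪x, T x⟫_ℂ = (q x : ℂ))
    (hn : ∀ x, ⟪T x, T x⟫_ℂ = (q x : ℂ)) : T * T = T :=
  clm_ext_inner fun x => by
    rw [mul_apply_eq_comp, ← ContinuousLinearMap.adjoint_inner_left, adjoint_eq_of_inner_real h,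
      hn, h]

theorem norm_sq_of_mul_self {T : K →L[ℂ] K} {q : K → ℝ} (h : ∀ x, ⟪x, T x⟫_ℂ = (q x : ℂ))
    (hT : T * T = T) (x : K) : ‖T x‖ ^ 2 = q x := by
  have h1 : ⟪T x, T x⟫_ℂ = q x := by
    rw [← ContinuousLinearMap.adjoint_inner_right, adjoint_eq_of_inner_real h,
      ← mul_apply_eq_comp, hT, h]
  rw [inner_self_eq_ofReal] at h1
  exact Complex.ofReal_injective h1

/-- Let S be the weak limit. Letting m and then n tend to infinity in (Tₙx, Tₘx) gives ‖Sx‖² = q(x)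
= (x, Sx). As q is real, S is self-adjoint, so this says S² = S. -/
theorem exists_projection_limit {T : ℕ → K →L[ℂ] K} {C : ℝ} {q : K → ℝ} {r : ℕ → K → ℂ}
    (hC : ∀ n x, ‖⟪x, T n x⟫_ℂ‖ ≤ C * ‖x‖ ^ 2)
    (hq : ∀ x, Tendsto (fun n => ⟪x, T n x⟫_ℂ) atTop (𝓝 (q x : ℂ)))
    (hr : ∀ n x, Tendsto (fun m => ⟪T n x, T m x⟫_ℂ) atTop (𝓝 (r n x)))
    (hrq : ∀ x, Tendsto (fun n => r n x) atTop (𝓝 (q x : ℂ))) :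
    ∃ S : K →L[ℂ] K, (∀ x, ⟪x, S x⟫_ℂ = (q x : ℂ)) ∧ S * S = S := by
  obtain ⟨S, hS, hw⟩ := exists_weak_limit hC hq
  refine ⟨S, hS, mul_self_of_norm_sq hS fun x => ?_⟩
  have h1 : ∀ n, ⟪T n x, S x⟫_ℂ = r n x := fun n => tendsto_nhds_unique (hw _ _) (hr n x)
  have h2 := (Complex.continuous_conj.tendsto _).comp (hw (S x) x)
  simp only [Function.comp_def, inner_conj_symm, h1] at h2
  exact tendsto_nhds_unique h2 (hrq x)

end Projections

theorem hasSum_measureReal {X : Type*} [MeasurableSpace X] (μ : Measure X) [IsFiniteMeasure μ]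
    {B : ℕ → Set X} (hB : ∀ n, MeasurableSet (B n)) (hd : Pairwise (Function.onFun Disjoint B)) :
    HasSum (fun n => μ.real (B n)) (μ.real (⋃ n, B n)) := by
  have h := measure_iUnion hd hB (μ := μ)
  have hs : ∑' n, μ (B n) ≠ ∞ := h ▸ measure_ne_top μ _
  simp only [measureReal_def, h, ENNReal.tsum_toReal_eq (fun n => measure_ne_top μ _)]
  exact ENNReal.hasSum_toReal hs

variable [CompleteSpace K]

/-! ### From a representation of C(X) to measures and projections -/

section Compact

variable {X : Type*} [TopologicalSpace X] (π : C(X, ℂ) →⋆ₐ[ℂ] (K →L[ℂ] K))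

theorem inner_starAlgHom (f g : C(X, ℂ)) (x : K) :
    ⟪π f x, π g x⟫_ℂ = ⟪x, π (star f * g) x⟫_ℂ := by
  rw [map_mul, map_star, ContinuousLinearMap.star_eq_adjoint, mul_apply_eq_comp,
    ContinuousLinearMap.adjoint_inner_right]

/-- A real continuous function as a complex one. -/
noncomputable def complexify : C(X, ℝ) →ₗ[ℝ] C(X, ℂ) where
  toFun f := ⟨fun t => (f t : ℂ), Complex.continuous_ofReal.comp f.continuous⟩
  map_add' f g := by ext; simp
  map_smul' c f := by ext; simp

theorem complexify_apply (f : C(X, ℝ)) (t : X) : complexify f t = (f t : ℂ) := rfl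

theorem conj_inner_complexify (f : C(X, ℝ)) (x : K) :
    starRingEnd ℂ ⟪x, π (complexify f) x⟫_ℂ = ⟪x, π (complexify f) x⟫_ℂ := by
  have h : star (complexify f) = complexify f := by
    ext t; simp [complexify_apply]
  rw [inner_conj_symm, ← ContinuousLinearMap.adjoint_inner_right,
    ← ContinuousLinearMap.star_eq_adjoint, ← map_star, h]

variable [MeasurableSpace X]

variable {π} in
theorem measureReal_univ_of_starAlgHom
    {μ : K → Measure X} (hμ : ∀ x (f : C(X, ℂ)), ⟪x, π f x⟫_ℂ = ∫ t, f t ∂μ x)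
    (x : K) : (μ x).real univ = ‖x‖ ^ 2 := by
  have h := hμ x 1
  rw [map_one, one_apply_eq_self, inner_self_eq_ofReal] at h
  apply Complex.ofReal_injective
  rw [h]
  simp

variable [BorelSpace X]

variable {π} {μ : K → Measure X} [∀ x, IsFiniteMeasure (μ x)]

/-- The indicator of B is the pointwise limit of continuous gₙ with values in [0, 1] that equal 1 on
B. Thus gₙ·1_B = 1_B, and the inner limit of (π(gₙ)x, π(gₘ)x) is already μₓ(B). -/
theorem exists_projection_of_isClosed [HasOuterApproxClosed X]
    (hμ : ∀ x (f : C(X, ℂ)), ⟪x, π f x⟫_ℂ = ∫ t, f t ∂μ x) {B : Set X} (hB : IsClosed B) :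
    ∃ P : K →L[ℂ] K, (∀ x, ⟪x, P x⟫_ℂ = ((μ x).real B : ℂ)) ∧ P * P = P := by
  let g : ℕ → C(X, ℂ) := fun n =>
    complexify ⟨fun t => (hB.apprSeq n t : ℝ), by fun_prop⟩
  have hgv : ∀ n t, g n t = ((hB.apprSeq n t : ℝ) : ℂ) := fun n t => rfl
  have hg1 : ∀ n t, ‖g n t‖ ≤ 1 := by
    intro n t
    rw [hgv, Complex.norm_real, Real.norm_of_nonneg NNReal.zero_le_coe]
    exact_mod_cast HasOuterApproxClosed.apprSeq_apply_le_one hB n t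
  have hlim : ∀ t, Tendsto (fun n => g n t) atTop (𝓝 (B.indicator (fun _ => (1 : ℂ)) t)) := by
    intro t
    have h := tendsto_pi_nhds.1 (HasOuterApproxClosed.tendsto_apprSeq hB) t
    have h2 := (Complex.continuous_ofReal.tendsto _).comp
      ((NNReal.continuous_coe.tendsto _).comp h)
    rw [show B.indicator (fun _ => (1 : ℂ)) t =
      (((B.indicator (fun _ => (1 : NNReal)) t : NNReal) : ℝ) : ℂ) by
        by_cases ht : t ∈ B <;> simp [ht]]
    exact h2
  have hval : ∀ x, ((μ x).real B : ℂ) = ∫ t, B.indicator (fun _ => (1 : ℂ)) t ∂μ x := fun x => by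
    rw [integral_indicator_const _ hB.measurableSet]; simp
  refine exists_projection_limit (T := fun n => π (g n)) (C := 1) (q := fun x => (μ x).real B)
    (r := fun _ x => (μ x).real B) (fun n x => ?_) (fun x => ?_) (fun n x => ?_)
    (fun x => tendsto_const_nhds)
  · rw [hμ, ← measureReal_univ_of_starAlgHom hμ]
    exact norm_integral_le_of_norm_le_const (ae_of_all _ (hg1 n))
  · simp_rw [hμ, hval]
    exact tendsto_integral_of_dominated_convergence (fun _ => 1)
      (fun n => (g n).continuous.aestronglyMeasurable) (integrable_const _)
      (fun n => ae_of_all _ (hg1 n)) (ae_of_all _ hlim)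
  · simp_rw [inner_starAlgHom, hμ, hval]
    refine tendsto_integral_of_dominated_convergence (fun _ => 1)
      (fun m => (star (g n) * g m).continuous.aestronglyMeasurable) (integrable_const _)
      (fun m => ae_of_all _ fun t => ?_) (ae_of_all _ fun t => ?_)
    · rw [ContinuousMap.mul_apply, norm_mul, ContinuousMap.star_apply, norm_star]
      exact mul_le_one₀ (hg1 n t) (norm_nonneg _) (hg1 m t)
    · have h := (hlim t).const_mul (star (g n) t)
      have e : star (g n) t * B.indicator (fun _ => (1 : ℂ)) t =
          B.indicator (fun _ => (1 : ℂ)) t := by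
        by_cases ht : t ∈ B
        · simp [ht, hgv, HasOuterApproxClosed.apprSeq_apply_eq_one hB n ht]
        · simp [ht]
      rwa [e] at h

/-- Counting mass shows that the projections of disjoint sets are mutually orthogonal. Their partial
sums Tₙ then satisfy TₙTₘ = Tₙ for n ≤ m, and the weak limit is idempotent. -/
theorem exists_projection_iUnion {X : Type*} [MeasurableSpace X] {μ : K → Measure X}
    [∀ x, IsFiniteMeasure (μ x)] (hμ : ∀ x, (μ x).real univ = ‖x‖ ^ 2) {B : ℕ → Set X}
    (hd : Pairwise (Function.onFun Disjoint B)) (hB : ∀ n, MeasurableSet (B n))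
    (h : ∀ n, ∃ P : K →L[ℂ] K, (∀ x, ⟪x, P x⟫_ℂ = ((μ x).real (B n) : ℂ)) ∧ P * P = P) :
    ∃ P : K →L[ℂ] K, (∀ x, ⟪x, P x⟫_ℂ = ((μ x).real (⋃ n, B n) : ℂ)) ∧ P * P = P := by
  choose P hP hPP using h
  have horth : ∀ i j, i ≠ j → P i * P j = 0 := by
    intro i j hij
    ext x
    have e : P j (P j x) = P j x := DFunLike.congr_fun (hPP j) x
    have h1 := norm_sq_of_mul_self (hP i) (hPP i) (P j x)
    have h2 := norm_sq_of_mul_self (hP j) (hPP j) (P j x)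
    rw [e] at h2
    have h3 : (μ (P j x)).real (B i ∪ B j) ≤ (μ (P j x)).real univ :=
      measureReal_mono (subset_univ _)
    rw [measureReal_union (hd hij) (hB j), hμ, ← h1, ← h2] at h3
    have h4 : ‖P i (P j x)‖ ^ 2 = 0 := le_antisymm (by linarith) (by positivity)
    simpa using h4
  let T : ℕ → K →L[ℂ] K := fun n => ∑ i ∈ Finset.range n, P i
  have hT : ∀ n x, ⟪x, T n x⟫_ℂ = ((∑ i ∈ Finset.range n, (μ x).real (B i) : ℝ) : ℂ) := by
    intro n x
    simp only [T, sum_apply, inner_sum, hP, Complex.ofReal_sum]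
  have hTT : ∀ n m, n ≤ m → T n * T m = T n := by
    intro n m hnm
    simp only [T, Finset.sum_mul_sum]
    refine Finset.sum_congr rfl fun i hi => ?_
    rw [Finset.sum_eq_single i (fun j _ hj => horth i j hj.symm), hPP]
    intro hi'
    exact absurd (Finset.mem_range.2 ((Finset.mem_range.1 hi).trans_le hnm)) hi'
  have hsum : ∀ x, Tendsto (fun n => ⟪x, T n x⟫_ℂ) atTop
      (𝓝 ((μ x).real (⋃ n, B n) : ℂ)) := by
    intro x
    simp_rw [hT]
    exact (Complex.continuous_ofReal.tendsto _).comp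
      (hasSum_measureReal (μ x) hB hd).tendsto_sum_nat
  refine exists_projection_limit (T := T) (C := 1) (r := fun n x => ⟪x, T n x⟫_ℂ)
    (fun n x => ?_) hsum (fun n x => ?_) hsum
  · rw [hT, Complex.norm_real, Real.norm_of_nonneg (by positivity), ← hμ, one_mul,
      ← measureReal_biUnion_finset (fun i _ j _ hij => hd hij) (fun i _ => hB i)]
    exact measureReal_mono (subset_univ _)
  · refine tendsto_const_nhds.congr' ?_
    filter_upwards [eventually_ge_atTop n] with m hm
    rw [← ContinuousLinearMap.adjoint_inner_right, adjoint_eq_of_inner_real (hT n),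
      ← mul_apply_eq_comp, hTT n m hm]

/-- The sets whose measures come from an idempotent form a Dynkin system containing the π-system of
closed sets. Intersections are never treated directly. -/
theorem exists_projection_of_measurableSet [HasOuterApproxClosed X]
    (hμ : ∀ x (f : C(X, ℂ)), ⟪x, π f x⟫_ℂ = ∫ t, f t ∂μ x) {B : Set X} (hB : MeasurableSet B) :
    ∃ P : K →L[ℂ] K, (∀ x, ⟪x, P x⟫_ℂ = ((μ x).real B : ℂ)) ∧ P * P = P := by
  have hu := measureReal_univ_of_starAlgHom hμ
  induction B, hB using MeasurableSpace.induction_on_inter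
    ((BorelSpace.measurable_eq (α := X)).trans borel_eq_generateFrom_isClosed)
    isPiSystem_isClosed with
  | empty => exact ⟨0, by simp, by simp⟩
  | basic B hB => exact exists_projection_of_isClosed hμ hB
  | compl B hB ih =>
    obtain ⟨P, hP, hPP⟩ := ih
    refine ⟨1 - P, fun x => ?_, ?_⟩
    · rw [sub_apply, one_apply_eq_self, inner_sub_right, hP, measureReal_compl hB, hu,
        inner_self_eq_ofReal, Complex.ofReal_sub]
    · rw [sub_mul, mul_sub, mul_sub, hPP]; simp
  | iUnion B hd hB ih => exact exists_projection_iUnion hu hd hB ih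

open scoped CompactlySupported in
-- For f ≥ 0 one has (x, π(f)x) = ‖π(√f)x‖² ≥ 0, so Riesz–Markov applies to real functions; complex
-- ones follow by splitting into real and imaginary parts.
theorem exists_measure_of_starAlgHom [CompactSpace X] [T2Space X]
    (π : C(X, ℂ) →⋆ₐ[ℂ] (K →L[ℂ] K)) (x : K) :
    ∃ μ : Measure X, IsFiniteMeasure μ ∧ ∀ f : C(X, ℂ), ⟪x, π f x⟫_ℂ = ∫ t, f t ∂μ := by
  let L : C(X, ℝ) →ₗ[ℝ] ℝ :=
    { toFun := fun f => (⟪x, π (complexify f) x⟫_ℂ).re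
      map_add' := fun f g => by
        rw [map_add, map_add, add_apply, inner_add_right, Complex.add_re]
      map_smul' := fun c f => by
        have : π (complexify (c • f)) = (c : ℂ) • π (complexify f) := by
          rw [← map_smul]; congr 1; ext t; simp [complexify_apply]
        rw [this, smul_apply, inner_smul_right, Complex.re_ofReal_mul]
        rfl }
  have hL : ∀ f : C(X, ℝ), 0 ≤ f → 0 ≤ L f := by
    intro f hf
    let g : C(X, ℝ) := ⟨fun t => √(f t), by fun_prop⟩
    have hfg : complexify f = star (complexify g) * complexify g := by
      ext t
      simp only [complexify_apply, ContinuousMap.mul_apply, ContinuousMap.star_apply,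
        RCLike.star_def, Complex.conj_ofReal]
      rw [← Complex.ofReal_mul, Complex.ofReal_inj]
      exact (Real.mul_self_sqrt (hf t)).symm
    change 0 ≤ (⟪x, π (complexify f) x⟫_ℂ).re
    rw [hfg, ← inner_starAlgHom, inner_self_eq_ofReal, Complex.ofReal_re]
    positivity
  let Λ : C_c(X, ℝ) →ₚ[ℝ] ℝ := PositiveLinearMap.mk₀
    { toFun := fun f => L f.toContinuousMap
      map_add' := fun f g => L.map_add f.toContinuousMap g.toContinuousMap
      map_smul' := fun c f => L.map_smul c f.toContinuousMap }
    (fun f hf => hL f.toContinuousMap hf)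
  let ρ := RealRMK.rieszMeasure Λ
  refine ⟨ρ, inferInstance, fun f => ?_⟩
  have hreal : ∀ g : C(X, ℝ), ⟪x, π (complexify g) x⟫_ℂ =
      ((∫ t, g t ∂ρ : ℝ) : ℂ) := by
    intro g
    have h := RealRMK.integral_rieszMeasure Λ ⟨g, HasCompactSupport.of_compactSpace _⟩
    change ∫ t, g t ∂ρ = (⟪x, π (complexify g) x⟫_ℂ).re at h
    rw [h]
    exact (Complex.conj_eq_iff_re.1 (conj_inner_complexify π g x)).symm
  let g : C(X, ℝ) := ⟨fun t => (f t).re, by fun_prop⟩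
  let h : C(X, ℝ) := ⟨fun t => (f t).im, by fun_prop⟩
  have hf : f = complexify g + Complex.I • complexify h := by
    ext t
    simp only [ContinuousMap.add_apply, ContinuousMap.smul_apply, complexify_apply, smul_eq_mul]
    rw [mul_comm]
    exact (Complex.re_add_im _).symm
  have hint : ∀ g : C(X, ℝ), Integrable (fun t => (g t : ℂ)) ρ :=
    fun g => ((complexify g).continuous.integrable_of_hasCompactSupport
      (HasCompactSupport.of_compactSpace _))
  rw [hf, map_add, map_smul, add_apply, inner_add_right, smul_apply, inner_smul_right,
    hreal, hreal]
  simp only [ContinuousMap.add_apply, ContinuousMap.smul_apply, complexify_apply, smul_eq_mul]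
  rw [integral_add (hint g) ((hint h).const_mul _), integral_const_mul]
  congr 1
  · exact integral_ofReal.symm
  · congr 1
    exact integral_ofReal.symm

end Compact

/-- The spectral measure with prescribed scalar measures. -/
noncomputable def SpectralMeasure.ofProjections (ν : K → Measure ℝ) [∀ x, IsFiniteMeasure (ν x)]
    (hν : ∀ x, (ν x).real univ = ‖x‖ ^ 2) (P : Set ℝ → K →L[ℂ] K)
    (hP : ∀ B, MeasurableSet B → ∀ x, ⟪x, P B x⟫_ℂ = ((ν x).real B : ℂ))
    (hPP : ∀ B, MeasurableSet B → P B * P B = P B) : SpectralMeasure K where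
  toFun := P
  empty := clm_ext_inner fun x => by rw [hP _ MeasurableSet.empty]; simp
  nonneg B hB := by
    rw [ContinuousLinearMap.isPositive_iff_complex]
    intro x
    rw [← inner_conj_symm, hP B hB, Complex.conj_ofReal]
    exact ⟨by simp, by simp⟩
  hasSum B hB hd x := by
    have hU := MeasurableSet.iUnion hB
    -- The remainder of a finite partial sum is the projection of the remaining set, so its squared
    -- norm on x is the ν-mass of that set, which tends to 0.
    have hF : ∀ F : Finset ℕ, P (⋃ j, B j) - ∑ j ∈ F, P (B j) =
        P ((⋃ j, B j) \ ⋃ j ∈ F, B j) := fun F => clm_ext_inner fun y => by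
      have hm : MeasurableSet (⋃ j ∈ F, B j) := F.measurableSet_biUnion fun j _ => hB j
      rw [hP _ (hU.diff hm), sub_apply, inner_sub_right, sum_apply, inner_sum, hP _ hU,
        measureReal_sdiff (iUnion₂_subset fun j _ => subset_iUnion B j) hm,
        measureReal_biUnion_finset (fun i _ j _ hij => hd hij) (fun i _ => hB i),
        Complex.ofReal_sub, Complex.ofReal_sum]
      simp only [hP _ (hB _)]
    have hsq : ∀ F : Finset ℕ, ‖∑ j ∈ F, P (B j) x - P (⋃ j, B j) x‖ ^ 2 =
        (ν x).real (⋃ j, B j) - ∑ j ∈ F, (ν x).real (B j) := by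
      intro F
      have hm : MeasurableSet (⋃ j ∈ F, B j) := F.measurableSet_biUnion fun j _ => hB j
      rw [norm_sub_rev, ← sum_apply, ← sub_apply, hF F,
        norm_sq_of_mul_self (hP _ (hU.diff hm)) (hPP _ (hU.diff hm)),
        measureReal_sdiff (iUnion₂_subset fun j _ => subset_iUnion B j) hm,
        measureReal_biUnion_finset (fun i _ j _ hij => hd hij) (fun i _ => hB i)]
    rw [HasSum, SummationFilter.unconditional_filter, tendsto_iff_norm_sub_tendsto_zero]
    have h0 : Tendsto (fun F : Finset ℕ => ‖∑ j ∈ F, P (B j) x - P (⋃ j, B j) x‖ ^ 2) atTop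
        (𝓝 0) := by
      simp_rw [hsq]
      have := (hasSum_measureReal (ν x) hB hd)
      rw [HasSum, SummationFilter.unconditional_filter] at this
      simpa using this.const_sub ((ν x).real (⋃ j, B j))
    simpa using h0.sqrt
  proj B hB := hPP B hB
  total := clm_ext_inner fun x => by
    rw [hP _ MeasurableSet.univ, hν, one_apply_eq_self, inner_self_eq_ofReal]

/-- The resolvent R = (A - i)⁻¹ is normal and injective. Its spectrum lies on the circle that t ↦
1/(t - i) traces, and its projections on the spectrum are carried to ℝ by the inverse of that map.
-/
theorem exists_spectralMeasure {A : K →ₗ.[ℂ] K} (hA : IsSelfAdjoint A) :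
    ∃ E : SpectralMeasure K, E.IsSpectralMeasureOf A := by
  have hs := isFormalAdjoint_of_isSelfAdjoint hA
  obtain ⟨R, hR⟩ := exists_isResolventAt hA (z := Complex.I) (by simp)
  obtain ⟨R', hR'⟩ := exists_isResolventAt hA (z := starRingEnd ℂ Complex.I) (by simp)
  have hadj : star R = R' := hR.adjoint_eq hs hR'
  have h1 : R - R' = (2 * Complex.I) • (R * R') := by
    rw [hR.sub_eq hR']; congr 1; rw [Complex.conj_I]; ring
  have h2 : R' - R = (-(2 * Complex.I)) • (R' * R) := by
    rw [hR'.sub_eq hR]; congr 1; rw [Complex.conj_I]; ring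
  have hI : (2 * Complex.I) ≠ 0 := by simp
  have hnormal : IsStarNormal R := by
    refine ⟨?_⟩
    rw [hadj, commute_iff_eq]
    refine smul_right_injective _ hI ?_
    change (2 * Complex.I) • (R' * R) = (2 * Complex.I) • (R * R')
    rw [← h1, ← neg_sub R' R, h2, neg_smul, neg_neg]
  have hinj : ∀ x, R x = 0 → x = 0 := by
    intro x hx
    obtain ⟨hd, e⟩ := hR.1 x
    have e0 : (⟨R x, hd⟩ : A.domain) = 0 := Subtype.ext hx
    rw [e0, LinearPMap.map_zero, hx] at e
    simpa using e.symm
  let X := spectrum ℂ R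
  let π : C(X, ℂ) →⋆ₐ[ℂ] (K →L[ℂ] K) := cfcHom hnormal
  let ι : C(X, ℂ) := ContinuousMap.restrict X (ContinuousMap.id ℂ)
  have hι : ∀ w : X, ι w = w := fun w => rfl
  have hπι : π ι = R := cfcHom_id hnormal
  -- The resolvent identity R - R* = 2i RR*, read on the spectrum, says that 1/w + i is real when w
  -- ≠ 0.
  have hcirc : ∀ w : X, (w : ℂ) - starRingEnd ℂ (w : ℂ) =
      2 * Complex.I * ((w : ℂ) * starRingEnd ℂ (w : ℂ)) := by
    have h : π (ι - star ι) = π ((2 * Complex.I) • (ι * star ι)) := by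
      rw [map_sub, map_smul, map_mul, map_star, hπι, hadj, h1]
    intro w
    exact DFunLike.congr_fun (cfcHom_injective hnormal h) w
  choose μ hfin hμ using exists_measure_of_starAlgHom π
  have hu := measureReal_univ_of_starAlgHom hμ
  choose! P hP hPP using fun (B : Set X) (hB : MeasurableSet B) =>
    exists_projection_of_measurableSet hμ hB
  -- the eigenvalue `0` of the resolvent carries no mass
  let Z : Set X := {w | (w : ℂ) = 0}
  have hzero : ∀ x, μ x Z = 0 := by
    intro x
    have hZm : MeasurableSet Z :=
      (isClosed_eq continuous_subtype_val continuous_const).measurableSet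
    -- All the mass of y sits where w = 0, so Ry = 0, and injectivity of R gives y = 0.
    set y := P Z x
    have hyy : P Z y = y := DFunLike.congr_fun (hPP Z hZm) x
    have hc : μ y Zᶜ = 0 := by
      have h := norm_sq_of_mul_self (hP Z hZm) (hPP Z hZm) y
      rw [hyy, ← hu] at h
      rw [← measureReal_eq_zero_iff, measureReal_compl hZm, h, sub_self]
    have hRy : R y = 0 := by
      have h : ⟪R y, R y⟫_ℂ = 0 := by
        rw [← hπι, inner_starAlgHom, hμ]
        refine integral_eq_zero_of_ae ?_
        rw [Filter.EventuallyEq, ae_iff]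
        refine measure_mono_null (fun w hw => ?_) hc
        rw [mem_compl_iff]
        intro hwZ
        apply hw
        have : ι w = 0 := hwZ
        simp [this]
      exact inner_self_eq_zero.1 h
    have h := hP Z hZm x
    rw [show P Z x = 0 from hinj y hRy, inner_zero_right] at h
    rw [← measureReal_eq_zero_iff]
    exact_mod_cast h.symm
  -- If w = 1/(t - i), then 1/w = t - i has real part t. At w = 0 the value is 0 by convention, on a
  -- null set.
  let φ : X → ℝ := fun w => ((w : ℂ)⁻¹).re
  have hφ : Measurable φ := by fun_prop
  have hν : ∀ x {B : Set ℝ}, MeasurableSet B → ((μ x).map φ).real B = (μ x).real (φ ⁻¹' B) :=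
    fun x B hB => map_measureReal_apply hφ hB
  have : ∀ x, IsFiniteMeasure ((μ x).map φ) := fun x => inferInstance
  let E := SpectralMeasure.ofProjections (fun x => (μ x).map φ)
    (fun x => by rw [hν x MeasurableSet.univ, preimage_univ, hu]) (fun B => P (φ ⁻¹' B))
    (fun B hB x => by rw [hP _ (hφ hB), hν x hB]) (fun B hB => hPP _ (hφ hB))
  have hEs : ∀ x, E.scalar x = (μ x).map φ := fun x =>
    E.measure_eq_scalar fun B hB => by
      rw [hν x hB]
      exact hP _ (hφ hB) x
  refine ⟨E, SpectralMeasure.isSpectralMeasureOf_of_isResolventAt hA (z := Complex.I) (by simp) ?_⟩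
  have hER : E.borelCalc (cauchyKernel Complex.I) = R := by
    refine E.borelCalc_eq fun x => ?_
    rw [hEs, integral_map hφ.aemeasurable (measurable_cauchyKernel _).aestronglyMeasurable,
      ← hπι, hμ]
    refine integral_congr_ae ?_
    have hae : ∀ᵐ w : X ∂μ x, (w : ℂ) ≠ 0 := by
      rw [ae_iff]
      simp only [ne_eq, not_not]
      exact hzero x
    filter_upwards [hae] with w hw
    have hw' : starRingEnd ℂ (w : ℂ) ≠ 0 := by simpa using hw
    have h := hcirc w
    have e : (φ w : ℂ) = (w : ℂ)⁻¹ + Complex.I := by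
      change ((((w : ℂ)⁻¹).re : ℝ) : ℂ) = _
      rw [Complex.re_eq_add_conj, map_inv₀]
      field_simp
      linear_combination h
    rw [cauchyKernel, e, hι]
    simp
  rw [hER]
  exact hR

end Construction

/-! ### Compressions -/

section Compress

variable {K : Type*} [NormedAddCommGroup K] [InnerProductSpace ℂ K] (N : Submodule ℂ K)
  [CompleteSpace N]

/-- The compression `T ↦ P_N T P_N |_N` as a bounded linear map. -/
noncomputable def compressL : (K →L[ℂ] K) →L[ℂ] (N →L[ℂ] N) :=
  ContinuousLinearMap.compL ℂ N K N N.orthogonalProjectionOnto ∘L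
    (ContinuousLinearMap.compL ℂ N K K).flip N.subtypeL

theorem compressL_apply_apply (T : K →L[ℂ] K) (ξ : N) :
    compressL N T ξ = N.orthogonalProjectionOnto (T ξ) := rfl

theorem compressL_one : compressL N 1 = 1 := by
  ext ξ
  simp [compressL_apply_apply]

theorem inner_compressL (T : K →L[ℂ] K) (ξ η : N) :
    ⟪ξ, compressL N T η⟫_ℂ = ⟪(ξ : K), T η⟫_ℂ := by
  simp [compressL_apply_apply]

theorem isPositive_compressL {T : K →L[ℂ] K} (h : T.IsPositive) : (compressL N T).IsPositive := by
  refine ⟨fun x y => ?_, fun x => ?_⟩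
  · simpa [compressL_apply_apply] using h.1 (x : K) (y : K)
  · simpa [ContinuousLinearMap.reApplyInnerSelf, compressL_apply_apply] using h.2 (x : K)

theorem adjoint_compressL [CompleteSpace K] (T : K →L[ℂ] K) :
    ContinuousLinearMap.adjoint (compressL N T) =
      compressL N (ContinuousLinearMap.adjoint T) :=
  clm_ext_inner fun ξ => by
    rw [ContinuousLinearMap.adjoint_inner_right, ← inner_conj_symm, inner_compressL,
      inner_compressL, inner_conj_symm, ContinuousLinearMap.adjoint_inner_right]

theorem opIm_compressL [CompleteSpace K] (T : K →L[ℂ] K) :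
    opIm (compressL N T) = compressL N (opIm T) := by
  rw [opIm, opIm, map_smul, map_sub, adjoint_compressL]

end Compress

/-! ### The Donoghue-type `m`-operator -/

/-- The function `t ↦ z + (z² + 1) / (t - z) = (1 + t z) / (t - z)`. -/
noncomputable def donoghueKernel (z : ℂ) (t : ℝ) : ℂ := z + (z ^ 2 + 1) * cauchyKernel z t

/-- The function `t ↦ (t² + 1) / |t - z|²`. -/
noncomputable def poissonRatio (z : ℂ) (t : ℝ) : ℝ := (t ^ 2 + 1) / ((t - z.re) ^ 2 + z.im ^ 2)

/-! ### Scalar kernels and the lower bound -/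

section Kernels

variable {z : ℂ}

theorem isBoundedBorel_donoghueKernel (hz : z.im ≠ 0) : IsBoundedBorel (donoghueKernel z) :=
  (IsBoundedBorel.const z).add ((IsBoundedBorel.const _).mul (isBoundedBorel_cauchyKernel hz))

theorem conj_donoghueKernel (z : ℂ) (t : ℝ) :
    starRingEnd ℂ (donoghueKernel (starRingEnd ℂ z) t) = donoghueKernel z t := by
  simp [donoghueKernel, cauchyKernel]

theorem donoghueKernel_sub_conj (hz : z.im ≠ 0) (t : ℝ) :
    (1 / (2 * Complex.I)) * (donoghueKernel z t - starRingEnd ℂ (donoghueKernel z t)) =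
      z.im * poissonRatio z t := by
  have h1 := ofReal_sub_ne_zero hz t
  have h2 : (t : ℂ) - starRingEnd ℂ z ≠ 0 := ofReal_sub_ne_zero (by simpa using hz) t
  have h3 : (((t - z.re) ^ 2 + z.im ^ 2 : ℝ) : ℂ) = (t - z) * (t - starRingEnd ℂ z) := by
    have : (t : ℂ) - starRingEnd ℂ z = starRingEnd ℂ ((t : ℂ) - z) := by simp
    rw [this, Complex.mul_conj, Complex.normSq_apply]
    simp
    ring
  have h4 : z - starRingEnd ℂ z = 2 * z.im * Complex.I := by
    rw [Complex.sub_conj]; push_cast; ring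
  rw [poissonRatio, Complex.ofReal_div, h3]
  simp only [donoghueKernel, cauchyKernel, map_add, map_mul, map_pow, map_one, map_div₀, map_sub,
    Complex.conj_ofReal]
  push_cast
  field_simp
  linear_combination ((t : ℂ) ^ 2 + 1) * h4

/-- After cross-multiplication the difference is (r - 1 + s)t² + 4 Re z · t + (1 - r + s), with r =
|z|² and s the square root. Its discriminant vanishes because s² - (r - 1)² = 4(Re z)², and its
leading coefficient is nonnegative because |r - 1| ≤ s. -/
theorem le_poissonRatio (hz : z.im ≠ 0) (t : ℝ) :
    2 / ((‖z‖ ^ 2 + 1) + √((‖z‖ ^ 2 - 1) ^ 2 + 4 * z.re ^ 2)) ≤ poissonRatio z t := by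
  set r := ‖z‖ ^ 2 with hr
  have hre : r = z.re ^ 2 + z.im ^ 2 := by
    rw [hr, Complex.sq_norm, Complex.normSq_apply]; ring
  set s := √((r - 1) ^ 2 + 4 * z.re ^ 2) with hs
  have hs0 : 0 ≤ s := Real.sqrt_nonneg _
  have hs2 : s ^ 2 = (r - 1) ^ 2 + 4 * z.re ^ 2 := Real.sq_sqrt (by positivity)
  have hr0 : 0 ≤ r := by positivity
  have hden : 0 < (t - z.re) ^ 2 + z.im ^ 2 := by positivity
  rw [poissonRatio, div_le_div_iff₀ (by positivity) hden]
  have habs : |r - 1| ≤ s := abs_le_of_sq_le_sq (by nlinarith [sq_nonneg z.re]) hs0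
  obtain ⟨ha, hb⟩ := abs_le.1 habs
  have key : 0 ≤ (r - 1 + s) * t ^ 2 + 4 * z.re * t + (1 - r + s) := by
    -- A vanishing leading coefficient forces Re z = 0, leaving a nonnegative constant; otherwise
    -- multiplying by it completes the square.
    rcases (show 0 ≤ r - 1 + s by linarith).eq_or_lt with h | h
    · have hx : z.re = 0 := by
        have : s = 1 - r := by linarith
        rw [this] at hs2
        have : z.re ^ 2 = 0 := by linarith
        simpa using this
      rw [← h, hx]
      linarith
    · refine nonneg_of_mul_nonneg_right ?_ h
      have : (r - 1 + s) * ((r - 1 + s) * t ^ 2 + 4 * z.re * t + (1 - r + s)) =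
          ((r - 1 + s) * t + 2 * z.re) ^ 2 := by linear_combination hs2
      rw [this]
      positivity
  linarith [hre, key]

theorem isBoundedBorel_poissonRatio (hz : z.im ≠ 0) :
    IsBoundedBorel fun t => (poissonRatio z t : ℂ) := by
  have h := (IsBoundedBorel.const ((z.im : ℂ)⁻¹ * (1 / (2 * Complex.I)))).mul
    ((isBoundedBorel_donoghueKernel hz).sub (isBoundedBorel_donoghueKernel hz).conj)
  convert h using 2 with t
  have : (z.im : ℂ) ≠ 0 := by exact_mod_cast hz
  rw [mul_assoc, donoghueKernel_sub_conj hz, inv_mul_cancel_left₀ this]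

end Kernels

section Differentiability

variable {F G : Type*} [NormedAddCommGroup F] [NormedSpace ℂ F] [NormedAddCommGroup G]
  [NormedSpace ℂ G]

theorem differentiableAt_smul_add_smul (a : G) {f : ℂ → G} {z : ℂ}
    (h : DifferentiableAt ℂ f z) :
    DifferentiableAt ℂ (fun z => z • a + (z ^ 2 + 1) • f z) z := by fun_prop

theorem differentiableAt_clm_comp (L : F →L[ℂ] G) {f : ℂ → F} {z : ℂ}
    (h : DifferentiableAt ℂ f z) : DifferentiableAt ℂ (fun z => L (f z)) z := by fun_prop

end Differentiability

/-! ### Analyticity, positivity and invertibility of the imaginary part -/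

section Donoghue

variable {K : Type*} [NormedAddCommGroup K] [InnerProductSpace ℂ K] {A : K →ₗ.[ℂ] K}
  {z : ℂ}

theorem IsResolventAt.norm_le (hs : A.IsFormalAdjoint A) (hz : z.im ≠ 0) {R : K →L[ℂ] K}
    (hR : IsResolventAt A z R) : ‖R‖ ≤ |z.im|⁻¹ := by
  refine R.opNorm_le_bound (by positivity) fun x => ?_
  obtain ⟨hx, e⟩ := hR.1 x
  have h := IsFormalAdjoint.abs_im_mul_norm_le hs z ⟨R x, hx⟩
  rw [e] at h
  rw [inv_mul_eq_div, le_div_iff₀ (abs_pos.2 hz), mul_comm]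
  exact h

theorem donoghueM_eq
    (N : Submodule ℂ K) [CompleteSpace N] (A : K →ₗ.[ℂ] K) (z : ℂ) :
    donoghueM A N z = z • (1 : N →L[ℂ] N) + (z ^ 2 + 1) • compressL N (resolventOp A z) := rfl

/-- From A(A - z)⁻¹ = 1 + z(A - z)⁻¹ one gets (zA + 1)(A - z)⁻¹ = z + (z² + 1)(A - z)⁻¹. -/
theorem donoghueM_apply_eq (N : Submodule ℂ K) [CompleteSpace N]
    (hR : IsResolventAt A z (resolventOp A z)) (ξ : N) (y : A.domain)
    (hy : (y : K) = resolventOp A z (ξ : K)) :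
    donoghueM A N z ξ = N.orthogonalProjectionOnto (z • A y + (y : K)) := by
  obtain ⟨hd, e⟩ := hR.1 ξ
  have hp : N.orthogonalProjectionOnto (ξ : K) = ξ := by simp
  have hyd : y = ⟨resolventOp A z ξ, hd⟩ := Subtype.ext hy
  rw [← hyd, ← hy, sub_eq_iff_eq_add] at e
  rw [e, donoghueM_eq, add_apply, smul_apply, smul_apply, one_apply_eq_self,
    compressL_apply_apply, ← hy, smul_add, map_add, map_add, map_smul, map_smul, map_smul, hp]
  module

variable [CompleteSpace K]

theorem isResolventAt_resolventOp (hA : IsSelfAdjoint A) (hz : z.im ≠ 0) :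
    IsResolventAt A z (resolventOp A z) := by
  obtain ⟨R, hR⟩ := exists_isResolventAt hA hz
  rwa [hR.resolventOp_eq]

/-- The difference quotient is (A - w)⁻¹(A - z)⁻¹ by the resolvent identity. Continuity at z follows
from the same identity and ‖(A - w)⁻¹‖ ≤ 1/|Im w|. -/
theorem hasDerivAt_resolventOp (hA : IsSelfAdjoint A) (hz : z.im ≠ 0) :
    HasDerivAt (resolventOp A) (resolventOp A z * resolventOp A z) z := by
  have hs := isFormalAdjoint_of_isSelfAdjoint hA
  have hne : ∀ᶠ w in 𝓝 z, w.im ≠ 0 :=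
    (Complex.continuous_im.continuousAt (x := z)).eventually_ne hz
  have hcont : Tendsto (resolventOp A) (𝓝 z) (𝓝 (resolventOp A z)) := by
    rw [tendsto_iff_norm_sub_tendsto_zero]
    have hb : Tendsto (fun w : ℂ => ‖w - z‖ * (|w.im|⁻¹ * ‖resolventOp A z‖)) (𝓝 z) (𝓝 0) := by
      have : ContinuousAt (fun w : ℂ => ‖w - z‖ * (|w.im|⁻¹ * ‖resolventOp A z‖)) z := by
        have : |z.im| ≠ 0 := abs_ne_zero.2 hz
        fun_prop (disch := assumption)
      simpa [ContinuousAt] using this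
    refine squeeze_zero' (Eventually.of_forall fun _ => norm_nonneg _) ?_ hb
    filter_upwards [hne] with w hw
    have hRw := isResolventAt_resolventOp hA hw
    rw [hRw.sub_eq (isResolventAt_resolventOp hA hz), norm_smul]
    gcongr
    refine (norm_mul_le _ _).trans ?_
    gcongr
    exact hRw.norm_le hs hw
  rw [hasDerivAt_iff_tendsto_slope]
  have h := (hcont.mul_const (resolventOp A z)).mono_left (nhdsWithin_le_nhds (s := {z}ᶜ))
  refine h.congr' ?_
  filter_upwards [nhdsWithin_le_nhds hne, self_mem_nhdsWithin] with w hw hwz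
  rw [slope_def_module, (isResolventAt_resolventOp hA hw).sub_eq (isResolventAt_resolventOp hA hz),
    inv_smul_smul₀ (sub_ne_zero.2 hwz)]

variable (N : Submodule ℂ K) [CompleteSpace N]

theorem analyticOnNhd_donoghueM (hA : IsSelfAdjoint A) :
    AnalyticOnNhd ℂ (donoghueM A N) {z | z.im ≠ 0} := by
  refine @DifferentiableOn.analyticOnNhd (N →L[ℂ] N) _ ContinuousLinearMap.toNormedSpace _ _ _
    (fun z hz => DifferentiableAt.differentiableWithinAt ?_)
    (isOpen_ne_fun Complex.continuous_im continuous_const)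
  exact @differentiableAt_smul_add_smul (N →L[ℂ] N) _ ContinuousLinearMap.toNormedSpace 1 _ z
    (@differentiableAt_clm_comp (K →L[ℂ] K) (N →L[ℂ] N) _ ContinuousLinearMap.toNormedSpace _
      ContinuousLinearMap.toNormedSpace (compressL N) _ z
      (hasDerivAt_resolventOp hA hz).differentiableAt)

variable {E : SpectralMeasure K}

theorem donoghueM_eq_compressL (hE : E.IsSpectralMeasureOf A) (hs : A.IsFormalAdjoint A)
    (hz : z.im ≠ 0) : donoghueM A N z = compressL N (E.borelCalc (donoghueKernel z)) := by
  have hc := isBoundedBorel_cauchyKernel hz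
  have h : E.borelCalc (donoghueKernel z) = z • 1 + (z ^ 2 + 1) • resolventOp A z := by
    rw [(hE.isResolventAt hs hz).resolventOp_eq, ← E.borelCalc_smul _ hc, ← E.borelCalc_one,
      ← E.borelCalc_smul z (.const 1), ← E.borelCalc_add ((IsBoundedBorel.const z).mul (.const 1))
        ((IsBoundedBorel.const _).mul hc)]
    simp only [mul_one]
    rfl
  rw [donoghueM_eq, h, map_add, map_smul, map_smul, compressL_one]

theorem opIm_donoghueM (hE : E.IsSpectralMeasureOf A) (hs : A.IsFormalAdjoint A)
    (hz : z.im ≠ 0) : opIm (donoghueM A N z) =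
      (z.im : ℂ) • compressL N (E.borelCalc fun t => (poissonRatio z t : ℂ)) := by
  have hk := isBoundedBorel_donoghueKernel hz
  rw [donoghueM_eq_compressL N hE hs hz, opIm_compressL, ← map_smul,
    ← E.borelCalc_smul _ (isBoundedBorel_poissonRatio hz), opIm, E.adjoint_borelCalc hk,
    ← E.borelCalc_sub hk hk.conj, ← E.borelCalc_smul _ (hk.sub hk.conj)]
  simp_rw [donoghueKernel_sub_conj hz]

theorem isPositive_compressL_poissonRatio_sub (E : SpectralMeasure K) (hz : z.im ≠ 0) :
    (compressL N (E.borelCalc fun t => (poissonRatio z t : ℂ)) -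
      ((2 / ((‖z‖ ^ 2 + 1) + √((‖z‖ ^ 2 - 1) ^ 2 + 4 * z.re ^ 2)) : ℝ) : ℂ) •
        (1 : N →L[ℂ] N)).IsPositive := by
  set c := 2 / ((‖z‖ ^ 2 + 1) + √((‖z‖ ^ 2 - 1) ^ 2 + 4 * z.re ^ 2)) with hc
  have hp := isBoundedBorel_poissonRatio hz
  have hb := hp.sub (.const (c : ℂ))
  have e : compressL N (E.borelCalc fun t => (poissonRatio z t : ℂ)) - (c : ℂ) • 1 =
      compressL N (E.borelCalc fun t => ((poissonRatio z t - c : ℝ) : ℂ)) := by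
    simp only [Complex.ofReal_sub]
    have h1 := E.borelCalc_smul (c : ℂ) (.const 1)
    simp only [mul_one, E.borelCalc_one] at h1
    rw [E.borelCalc_sub hp (.const _), map_sub, h1, map_smul, compressL_one]
  rw [e]
  refine isPositive_compressL N (E.isPositive_borelCalc ?_ fun t => ?_)
  · simpa only [Complex.ofReal_sub] using hb
  · exact sub_nonneg.2 (le_poissonRatio hz t)

theorem smul_one_le_opIm_donoghueM (hE : E.IsSpectralMeasureOf A) (hs : A.IsFormalAdjoint A)
    (hz : z.im ≠ 0) :
    ((2 / ((‖z‖ ^ 2 + 1) + √((‖z‖ ^ 2 - 1) ^ 2 + 4 * z.re ^ 2)) : ℝ) : ℂ) • (1 : N →L[ℂ] N)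
      ≤ ((z.im⁻¹ : ℝ) : ℂ) • opIm (donoghueM A N z) := by
  have hz' : (z.im : ℂ) ≠ 0 := by exact_mod_cast hz
  rw [ContinuousLinearMap.le_def, opIm_donoghueM N hE hs hz, Complex.ofReal_inv,
    inv_smul_smul₀ hz']
  exact isPositive_compressL_poissonRatio_sub N E hz

/-- The lower bound gives |(Tξ, ξ)| ≥ |Im z| c ‖ξ‖² for T = Im M(z), and a coercive bounded operator
is invertible. Absolute values cover both half-planes, as Im M(z) is negative in the lower one. -/
theorem isUnit_opIm_donoghueM (hE : E.IsSpectralMeasureOf A) (hs : A.IsFormalAdjoint A)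
    (hz : z.im ≠ 0) : IsUnit (opIm (donoghueM A N z)) := by
  set c := 2 / ((‖z‖ ^ 2 + 1) + √((‖z‖ ^ 2 - 1) ^ 2 + 4 * z.re ^ 2)) with hc
  have hc0 : 0 < c := by positivity
  have hy : 0 < |z.im| := abs_pos.2 hz
  refine ContinuousLinearMap.isUnit_of_forall_le_norm_inner_map _
    (c := ⟨|z.im| * c, by positivity⟩) (by exact mul_pos hy hc0) fun ξ => ?_
  have hpos := (isPositive_compressL_poissonRatio_sub N E hz).re_inner_nonneg_left ξ
  rw [opIm_donoghueM N hE hs hz, smul_apply, inner_smul_left, norm_mul, RCLike.norm_conj,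
    Complex.norm_real, Real.norm_eq_abs]
  rw [sub_apply, inner_sub_left, smul_apply, one_apply_eq_self, inner_smul_left,
    inner_self_eq_ofReal, Complex.conj_ofReal, map_sub, sub_nonneg, ← hc,
    RCLike.re_eq_complex_re, ← Complex.ofReal_mul, Complex.ofReal_re] at hpos
  calc ‖ξ‖ ^ 2 * (|z.im| * c) = |z.im| * (c * ‖ξ‖ ^ 2) := by ring
    _ ≤ _ := by
      gcongr
      exact hpos.trans (Complex.re_le_norm _)

theorem isNevanlinnaHerglotz_donoghueM (hE : E.IsSpectralMeasureOf A) (hA : IsSelfAdjoint A) :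
    IsNevanlinnaHerglotz (donoghueM A N) := by
  have hs := isFormalAdjoint_of_isSelfAdjoint hA
  refine ⟨(analyticOnNhd_donoghueM N hA).mono fun z hz => (ne_of_gt hz : z.im ≠ 0),
    fun z hz => ?_, fun z hz => ?_⟩
  · have hp := isBoundedBorel_poissonRatio hz.ne'
    rw [ContinuousLinearMap.nonneg_iff_isPositive, opIm_donoghueM N hE hs hz.ne', ← map_smul,
      ← E.borelCalc_smul _ hp]
    have hb := (IsBoundedBorel.const (z.im : ℂ)).mul hp
    simp only [← Complex.ofReal_mul] at hb ⊢
    refine isPositive_compressL N (E.isPositive_borelCalc hb fun t => ?_)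
    have : 0 ≤ poissonRatio z t := by rw [poissonRatio]; positivity
    positivity
  · have hz' : (starRingEnd ℂ z).im ≠ 0 := by simpa using hz.ne
    rw [donoghueM_eq_compressL N hE hs hz.ne, donoghueM_eq_compressL N hE hs hz',
      adjoint_compressL, E.adjoint_borelCalc (isBoundedBorel_donoghueKernel hz')]
    simp_rw [conj_donoghueKernel]

end Donoghue

/-! ### The measure of the `m`-operator -/

/-- The weight `t ↦ t² + 1`. -/
noncomputable def weight (t : ℝ) : ℂ := ((t ^ 2 + 1 : ℝ) : ℂ)

theorem continuous_weight : Continuous weight := by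
  unfold weight
  fun_prop

theorem weight_ne_zero (t : ℝ) : weight t ≠ 0 := by
  rw [weight]
  exact_mod_cast (by positivity : t ^ 2 + 1 ≠ 0)

theorem isBoundedBorel_indicator_weight {B : Set ℝ} (hB : MeasurableSet B)
    (hb : Bornology.IsBounded B) : IsBoundedBorel (B.indicator weight) :=
  isBoundedBorel_indicator_of_continuous continuous_weight hB hb

theorem indicator_weight_eq (B : Set ℝ) :
    B.indicator weight = fun t => ((B.indicator (fun t => t ^ 2 + 1) t : ℝ) : ℂ) := by
  ext t
  by_cases h : t ∈ B <;> simp [h, weight]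

/-- Rounding the real and the imaginary part down to multiples of 1/(n + 1) costs at most 1/(n + 1)
each. Boundedness leaves finitely many values, and the approximation is uniform, as
`HasStrongIntegralOn` demands. -/
theorem exists_simpleFunc_norm_sub_le {f : ℝ → ℂ} (hf : IsBoundedBorel f) (n : ℕ) :
    ∃ s : SimpleFunc ℝ ℂ, ∀ t, ‖s t - f t‖ ≤ 2 / (n + 1) := by
  obtain ⟨hf, C, hC⟩ := hf
  have hfl : ∀ g : ℝ → ℝ, Measurable g → (∀ t, |g t| ≤ C) →
      ∃ s : SimpleFunc ℝ ℝ, ∀ t, |s t - g t| ≤ 1 / (n + 1) := by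
    intro g hg hgC
    have hm : Measurable fun t => ⌊(n + 1) * g t⌋ := Int.measurable_floor.comp (hg.const_mul _)
    have hfin : (range fun t => ⌊(n + 1) * g t⌋).Finite := by
      refine (finite_Icc ⌊-((n + 1) * C)⌋ ⌊(n + 1) * C⌋).subset ?_
      rintro _ ⟨t, rfl⟩
      obtain ⟨h1, h2⟩ := abs_le.1 (hgC t)
      refine ⟨Int.floor_mono ?_, Int.floor_mono ?_⟩
      · rw [← mul_neg]; gcongr
      · gcongr
    let s : SimpleFunc ℝ ℤ := ⟨_, fun k => hm (measurableSet_singleton k), hfin⟩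
    refine ⟨s.map fun k : ℤ => (k : ℝ) / (n + 1), fun t => ?_⟩
    have hpos : (0 : ℝ) < n + 1 := by positivity
    change |(⌊(n + 1) * g t⌋ : ℝ) / (n + 1) - g t| ≤ 1 / (n + 1)
    have e : (⌊(n + 1) * g t⌋ : ℝ) / (n + 1) - g t =
        -((n + 1) * g t - ⌊(n + 1) * g t⌋) / (n + 1) := by field_simp; ring
    rw [e, abs_div, abs_neg, abs_of_pos hpos, abs_of_nonneg (Int.fract_nonneg _)]
    gcongr
    exact (Int.fract_lt_one _).le
  obtain ⟨a, ha⟩ := hfl (fun t => (f t).re) (Complex.measurable_re.comp hf)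
    fun t => (Complex.abs_re_le_norm _).trans (hC t)
  obtain ⟨b, hb⟩ := hfl (fun t => (f t).im) (Complex.measurable_im.comp hf)
    fun t => (Complex.abs_im_le_norm _).trans (hC t)
  refine ⟨(a.pair b).map fun p => ⟨p.1, p.2⟩, fun t => ?_⟩
  refine (Complex.norm_le_abs_re_add_abs_im _).trans ?_
  have h1 := ha t
  have h2 := hb t
  calc _ ≤ 1 / ((n : ℝ) + 1) + 1 / (n + 1) := add_le_add h1 h2
    _ = _ := by ring

theorem measure_ext_of_isBounded {μ ν : Measure ℝ}
    (h : ∀ B, MeasurableSet B → Bornology.IsBounded B → μ B = ν B) : μ = ν := by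
  ext B hB
  have key : ∀ ρ : Measure ℝ, ρ B = ∑' k : ℤ, ρ (B ∩ Ioc (k : ℝ) (k + 1)) := fun ρ => by
    rw [← measure_iUnion (fun i j hij => (pairwise_disjoint_Ioc_intCast ℝ hij).mono
      inter_subset_right inter_subset_right) (fun k => hB.inter measurableSet_Ioc),
      ← inter_iUnion, iUnion_Ioc_intCast, inter_univ]
  rw [key μ, key ν]
  exact tsum_congr fun k => h _ (hB.inter measurableSet_Ioc)
    ((Metric.isBounded_Ioc _ _).subset inter_subset_right)

theorem isBoundedBorel_div_sq_add_one :
    IsBoundedBorel fun t : ℝ => (t : ℂ) / ((t : ℂ) ^ 2 + 1) := by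
  refine .of_bound (by fun_prop) 1 fun t => ?_
  have e : (t : ℂ) / ((t : ℂ) ^ 2 + 1) = ((t / (t ^ 2 + 1) : ℝ) : ℂ) := by push_cast; rfl
  rw [e, Complex.norm_real, Real.norm_eq_abs, abs_div, abs_of_pos (by positivity : 0 < t ^ 2 + 1),
    div_le_one (by positivity)]
  nlinarith [sq_nonneg (|t| - 1), sq_abs t]

theorem isBoundedBorel_one_div_one_add_sq :
    IsBoundedBorel fun t : ℝ => 1 / (1 + (t : ℂ) ^ 2) := by
  refine .of_bound (by fun_prop) 1 fun t => ?_
  have e : 1 / (1 + (t : ℂ) ^ 2) = ((1 / (1 + t ^ 2) : ℝ) : ℂ) := by push_cast; rfl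
  rw [e, Complex.norm_real, Real.norm_of_nonneg (by positivity), div_le_one (by positivity)]
  nlinarith [sq_nonneg t]

/-! ### Construction of Ω, strong integrals and total mass -/

section DonoghueMeasure

variable {K : Type*} [NormedAddCommGroup K] [InnerProductSpace ℂ K]

theorem scalar_compress (E : SpectralMeasure K) (N : Submodule ℂ K) [CompleteSpace N] (ξ : N) :
    (E.compress N).scalar ξ = E.scalar (ξ : K) :=
  (E.compress N).measure_eq_scalar fun B hB =>
    (inner_compressL N (E.toFun B) ξ ξ).trans (E.inner_toFun _ hB)

variable [CompleteSpace K]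

theorem SpectralMeasure.borelCalc_sum (E : SpectralMeasure K) {ι : Type*} (F : Finset ι)
    {f : ι → ℝ → ℂ} (hf : ∀ i, IsBoundedBorel (f i)) :
    E.borelCalc (fun t => ∑ i ∈ F, f i t) = ∑ i ∈ F, E.borelCalc (f i) :=
  E.borelCalc_eq fun x => by
    rw [sum_apply, inner_sum, integral_finsetSum F fun i _ => (hf i).integrable _]
    exact Finset.sum_congr rfl fun i _ => E.inner_borelCalc (hf i) x

variable (E : SpectralMeasure K) (N : Submodule ℂ K) [CompleteSpace N]

/-- The measure `dΩ(λ) = (λ² + 1) d(P_N E(λ) P_N |_N)`. -/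
noncomputable def donoghueMeasure : LocalOperatorMeasure N where
  toFun B := compressL N (E.borelCalc (B.indicator weight))
  empty := by
    rw [indicator_empty]
    exact (congrArg _ E.borelCalc_zero).trans (map_zero _)
  nonneg B hB hb := by
    have h := isBoundedBorel_indicator_weight hB hb
    rw [indicator_weight_eq] at h ⊢
    exact isPositive_compressL N (E.isPositive_borelCalc h fun t =>
      indicator_nonneg (fun t _ => by positivity) t)
  hasSum B hB hd hb ξ := by
    have hU := isBoundedBorel_indicator_weight (MeasurableSet.iUnion hB) hb
    -- The weight is bounded on the bounded union, so each piece is one fixed bounded operator times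
    -- E(Bⱼ), and countable additivity is inherited from E.
    have e : ∀ j, E.borelCalc ((B j).indicator weight) =
        E.borelCalc ((⋃ j, B j).indicator weight) * E.toFun (B j) := fun j => by
      rw [E.borelCalc_mul_toFun hU (hB j), indicator_indicator,
        inter_eq_left.2 (subset_iUnion B j)]
    have e' : E.borelCalc ((⋃ j, B j).indicator weight) =
        E.borelCalc ((⋃ j, B j).indicator weight) * E.toFun (⋃ j, B j) := by
      rw [E.borelCalc_mul_toFun hU (MeasurableSet.iUnion hB), indicator_indicator, inter_self]
    have h := ((E.hasSum B hB hd (ξ : K)).mapL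
      (E.borelCalc ((⋃ j, B j).indicator weight))).mapL N.orthogonalProjectionOnto
    simp only [← mul_apply_eq_comp, ← e, ← e'] at h
    exact h

theorem donoghueMeasure_toFun (B : Set ℝ) :
    (donoghueMeasure E N).toFun B = compressL N (E.borelCalc (B.indicator weight)) := rfl

theorem scalar_donoghueMeasure (ξ : N) : (donoghueMeasure E N).scalar ξ =
    (E.scalar (ξ : K)).withDensity fun t => ENNReal.ofReal (t ^ 2 + 1) := by
  refine measure_ext_of_isBounded fun B hB hb => ?_
  have h := isBoundedBorel_indicator_weight hB hb
  rw [LocalOperatorMeasure.scalar_apply _ _ hB hb, donoghueMeasure_toFun, inner_compressL,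
    E.inner_borelCalc h, withDensity_apply _ hB, ← lintegral_indicator hB]
  have hi : Integrable (B.indicator fun t : ℝ => t ^ 2 + 1) (E.scalar (ξ : K)) := by
    refine (h.integrable (E.scalar (ξ : K))).re.congr (ae_of_all _ fun t => ?_)
    rw [indicator_weight_eq]
    simp
  have e : ∫ t, B.indicator weight t ∂E.scalar (ξ : K) =
      ((∫ t, B.indicator (fun t : ℝ => t ^ 2 + 1) t ∂E.scalar (ξ : K) : ℝ) : ℂ) := by
    rw [indicator_weight_eq]
    exact integral_ofReal
  rw [e, Complex.ofReal_re, ofReal_integral_eq_lintegral_ofReal hi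
    (ae_of_all _ fun t => indicator_nonneg (fun t _ => by positivity) t)]
  congr 1; ext t
  by_cases ht : t ∈ B <;> simp [ht]

theorem simpleIntegral_donoghueMeasure {B : Set ℝ} (hB : MeasurableSet B)
    (hb : Bornology.IsBounded B) (s : SimpleFunc ℝ ℂ) :
    (donoghueMeasure E N).simpleIntegral B s =
      compressL N (E.borelCalc fun t => s t * B.indicator weight t) := by
  have hbd : ∀ c, IsBoundedBorel ((s ⁻¹' {c} ∩ B).indicator weight) := fun c =>
    isBoundedBorel_indicator_weight ((s.measurableSet_fiber c).inter hB)
      (hb.subset inter_subset_right)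
  have e : (fun t => s t * B.indicator weight t) =
      fun t => ∑ c ∈ s.range, c * (s ⁻¹' {c} ∩ B).indicator weight t := by
    ext t
    rw [Finset.sum_eq_single (s t)]
    · by_cases h : t ∈ B <;> simp [h]
    · intro c _ hc
      rw [indicator_of_notMem, mul_zero]
      exact fun h => hc h.1.symm
    · intro h
      exact absurd (s.mem_range_self t) h
  rw [e, E.borelCalc_sum _ fun c => (IsBoundedBorel.const c).mul (hbd c), map_sum]
  refine Finset.sum_congr rfl fun c _ => ?_
  rw [E.borelCalc_smul c (hbd c), map_smul, donoghueMeasure_toFun]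

theorem hasStrongIntegralOn_donoghueMeasure {f : ℝ → ℂ} (hf : IsBoundedBorel f) {B : Set ℝ}
    (hB : MeasurableSet B) (hb : Bornology.IsBounded B) :
    (donoghueMeasure E N).HasStrongIntegralOn B f
      (compressL N (E.borelCalc fun t => f t * B.indicator weight t)) := by
  choose s hs using exists_simpleFunc_norm_sub_le hf
  have hlim : Tendsto (fun n : ℕ => 2 / ((n : ℝ) + 1)) atTop (𝓝 0) := by
    have := (tendsto_one_div_add_atTop_nhds_zero_nat (𝕜 := ℝ)).const_mul 2
    simpa [div_eq_mul_inv] using this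
  have hu : ∀ t, Tendsto (fun n => s n t) atTop (𝓝 (f t)) := fun t => by
    rw [tendsto_iff_norm_sub_tendsto_zero]
    exact squeeze_zero (fun _ => norm_nonneg _) (fun n => hs n t) hlim
  refine ⟨s, ?_, fun ξ => ?_⟩
  · rw [Metric.tendstoUniformlyOn_iff]
    intro ε hε
    filter_upwards [hlim.eventually_lt_const hε] with n hn t _
    rw [dist_comm, dist_eq_norm]
    exact (hs n t).trans_lt hn
  · have hw := isBoundedBorel_indicator_weight hB hb
    obtain ⟨hfm, C, hC⟩ := id hf
    obtain ⟨hwm, D, hD⟩ := id hw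
    simp_rw [simpleIntegral_donoghueMeasure E N hB hb, compressL_apply_apply]
    refine (N.orthogonalProjectionOnto.continuous.tendsto _).comp
      (E.tendsto_borelCalc (C := (2 + C) * D) (fun n => (s n).measurable.mul hwm)
        (fun n t => ?_) (fun t => (hu t).mul_const _) (hf.mul hw) ξ)
    have h2 : ‖s n t‖ ≤ 2 + C := by
      calc ‖s n t‖ = ‖(s n t - f t) + f t‖ := by rw [sub_add_cancel]
        _ ≤ 2 / (n + 1) + C := (norm_add_le _ _).trans (add_le_add (hs n t) (hC t))
        _ ≤ 2 + C := by
          gcongr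
          exact div_le_self (by norm_num) (by simp)
    rw [Pi.mul_apply, norm_mul]
    exact mul_le_mul h2 (hD t) (norm_nonneg _) ((norm_nonneg _).trans h2)

/-- The weight is unbounded, but its product g with f is bounded. The integral over Bₙ is therefore
the compression of (∫ g dE)E(Bₙ), and E(Bₙ) tends strongly to 1. -/
theorem hasStrongIntegral_donoghueMeasure {f g : ℝ → ℂ} (hf : IsBoundedBorel f)
    (hg : IsBoundedBorel g) (hfg : ∀ t, f t * weight t = g t) :
    (donoghueMeasure E N).HasStrongIntegral f (compressL N (E.borelCalc g)) := by
  refine ⟨fun B => compressL N (E.borelCalc fun t => f t * B.indicator weight t),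
    fun B hB hb => hasStrongIntegralOn_donoghueMeasure E N hf hB hb, fun B hB _ hmono hU ξ => ?_⟩
  have e : ∀ n, E.borelCalc (fun t => f t * (B n).indicator weight t) =
      E.borelCalc g * E.toFun (B n) := fun n => by
    rw [E.borelCalc_mul_toFun hg (hB n)]
    congr 1; ext t
    by_cases h : t ∈ B n <;> simp [h, hfg]
  simp_rw [e, compressL_apply_apply, mul_apply_eq_comp]
  exact ((N.orthogonalProjectionOnto.continuous.comp (E.borelCalc g).continuous).tendsto _).comp
    (E.tendsto_toFun hB hmono hU (ξ : K))

theorem hasStrongIntegral_donoghueM {E : SpectralMeasure K} {A : K →ₗ.[ℂ] K} {z : ℂ}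
    (hE : E.IsSpectralMeasureOf A) (hs : A.IsFormalAdjoint A) (hz : z.im ≠ 0) :
    (donoghueMeasure E N).HasStrongIntegral
      (fun t => 1 / ((t : ℂ) - z) - (t : ℂ) / ((t : ℂ) ^ 2 + 1)) (donoghueM A N z) := by
  rw [donoghueM_eq_compressL N hE hs hz]
  refine hasStrongIntegral_donoghueMeasure E N
    ((isBoundedBorel_cauchyKernel hz).sub isBoundedBorel_div_sq_add_one)
    (isBoundedBorel_donoghueKernel hz) fun t => ?_
  have h1 := ofReal_sub_ne_zero hz t
  have h2 : (t : ℂ) ^ 2 + 1 ≠ 0 := by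
    have := weight_ne_zero t
    rw [weight] at this
    exact_mod_cast this
  rw [donoghueKernel, cauchyKernel, weight]
  push_cast
  field_simp
  ring

theorem hasStrongIntegral_one :
    (donoghueMeasure E N).HasStrongIntegral (fun t => 1 / (1 + (t : ℂ) ^ 2)) 1 := by
  rw [← compressL_one N, ← E.borelCalc_one]
  refine hasStrongIntegral_donoghueMeasure E N isBoundedBorel_one_div_one_add_sq (.const 1)
    fun t => ?_
  have h2 : 1 + (t : ℂ) ^ 2 ≠ 0 := by
    have := weight_ne_zero t
    rw [weight, add_comm] at this
    exact_mod_cast this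
  rw [weight]
  push_cast
  field_simp
  ring

/-- The masses ∫ (t² + 1) and ∫ t² against (ξ, Eξ) differ by the finite total mass of that measure.
-/
theorem scalar_donoghueMeasure_univ_eq_top_iff {E : SpectralMeasure K} {A : K →ₗ.[ℂ] K}
    (hE : E.IsSpectralMeasureOf A) (ξ : N) :
    (donoghueMeasure E N).scalar ξ univ = ∞ ↔ (ξ : K) ∉ A.domain := by
  rw [hE.mem_domain_iff, scalar_donoghueMeasure, withDensity_apply _ MeasurableSet.univ,
    setLIntegral_univ, not_lt, top_le_iff]
  have e : ∫⁻ t, ENNReal.ofReal (t ^ 2 + 1) ∂E.scalar (ξ : K) =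
      ∫⁻ t, ENNReal.ofReal (t ^ 2) ∂E.scalar (ξ : K) + E.scalar (ξ : K) univ := by
    rw [← lintegral_one, ← lintegral_add_right _ measurable_const]
    congr 1; ext t
    rw [ENNReal.ofReal_add (by positivity) zero_le_one, ENNReal.ofReal_one]
  rw [e, ENNReal.add_eq_top]
  exact or_iff_left (measure_ne_top _ _)

/-- The adjoint of S agrees with the symmetric extension A on x, so Ax = zx with z nonreal. -/
theorem eq_zero_of_mem_domain_of_mem_deficiencySpace {S A : K →ₗ.[ℂ] K}
    (hS : Dense (S.domain : Set K)) (hA : A.IsFormalAdjoint A) (hSA : S ≤ A) {z : ℂ}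
    (hz : z.im ≠ 0) {x : K} (hx : x ∈ A.domain) (hxz : x ∈ deficiencySpace S z) : x = 0 := by
  obtain ⟨hxS, e⟩ := hxz
  have hadj : S.adjoint ⟨x, hxS⟩ = A ⟨x, hx⟩ := by
    refine LinearPMap.adjoint_apply_eq hS _ fun v => ?_
    have hv : S v = A ⟨v, hSA.1 v.2⟩ := hSA.2 rfl
    rw [hv]
    exact hA ⟨x, hx⟩ ⟨v, hSA.1 v.2⟩
  have h := IsFormalAdjoint.abs_im_mul_norm_le hA z ⟨x, hx⟩
  rw [← hadj, e, sub_self, norm_zero] at h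
  exact norm_le_zero_iff.1 (nonpos_of_mul_nonpos_right h (abs_pos.2 hz))

end DonoghueMeasure

theorem theoremt5p3 {K : Type*} [NormedAddCommGroup K] [InnerProductSpace ℂ K] [CompleteSpace K]
    [TopologicalSpace.SeparableSpace K]
    (Adot : K →ₗ.[ℂ] K) (hAdot : IsClosedSymmetricWithEqualIndices Adot)
    (A : K →ₗ.[ℂ] K) (hA : IsSelfAdjoint A) (hext : Adot ≤ A)
    (N : Submodule ℂ K) [CompleteSpace N] :
    -- the resolvent exists off the real axis, and both expressions for `M(z)` agree
    (∀ z : ℂ, z.im ≠ 0 → IsResolventAt A z (resolventOp A z) ∧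
      ∀ ξ : N, ∀ y : A.domain, (y : K) = resolventOp A z (ξ : K) →
        donoghueM A N z ξ = N.orthogonalProjectionOnto (z • A y + (y : K))) ∧
    -- analyticity
    AnalyticOnNhd ℂ (donoghueM A N) {z | z.im ≠ 0} ∧
    -- the lower bound
    (∀ z : ℂ, z.im ≠ 0 →
      ((2 / ((‖z‖ ^ 2 + 1) + √((‖z‖ ^ 2 - 1) ^ 2 + 4 * z.re ^ 2)) : ℝ) : ℂ) • (1 : N →L[ℂ] N)
        ≤ ((z.im⁻¹ : ℝ) : ℂ) • opIm (donoghueM A N z)) ∧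
    -- bounded invertibility of the imaginary part
    (∀ z : ℂ, z.im ≠ 0 → IsUnit (opIm (donoghueM A N z))) ∧
    -- the Nevanlinna--Herglotz property
    IsNevanlinnaHerglotz (donoghueM A N) ∧
    -- the Nevanlinna--Herglotz representation
    (∃ E : SpectralMeasure K, E.IsSpectralMeasureOf A) ∧
    ∀ E : SpectralMeasure K, E.IsSpectralMeasureOf A →
      ∃ Ω : LocalOperatorMeasure N,
        (∀ ξ : N, Ω.scalar ξ =
          ((E.compress N).scalar ξ).withDensity (fun t => ENNReal.ofReal (t ^ 2 + 1))) ∧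
        (∀ z : ℂ, z.im ≠ 0 →
          Ω.HasStrongIntegral (fun t => 1 / ((t : ℂ) - z) - (t : ℂ) / ((t : ℂ) ^ 2 + 1))
            (donoghueM A N z)) ∧
        Ω.HasStrongIntegral (fun t => 1 / (1 + (t : ℂ) ^ 2)) 1 ∧
        (∀ ξ : N, Ω.scalar ξ univ = ∞ ↔ (ξ : K) ∉ A.domain) ∧
        (∀ z₀ : ℂ, z₀.im ≠ 0 → N ≤ deficiencySpace Adot z₀ →
          ∀ ξ : N, ξ ≠ 0 → Ω.scalar ξ univ = ∞) := by
  have hs := isFormalAdjoint_of_isSelfAdjoint hA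
  obtain ⟨E₀, hE₀⟩ := exists_spectralMeasure hA
  refine ⟨fun z hz => ⟨isResolventAt_resolventOp hA hz, fun ξ y hy =>
      donoghueM_apply_eq N (isResolventAt_resolventOp hA hz) ξ y hy⟩,
    analyticOnNhd_donoghueM N hA, fun z hz => smul_one_le_opIm_donoghueM N hE₀ hs hz,
    fun z hz => isUnit_opIm_donoghueM N hE₀ hs hz, isNevanlinnaHerglotz_donoghueM N hE₀ hA,
    ⟨E₀, hE₀⟩, fun E hE => ⟨donoghueMeasure E N, fun ξ => ?_,
      fun z hz => hasStrongIntegral_donoghueM N hE hs hz, hasStrongIntegral_one E N,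
      scalar_donoghueMeasure_univ_eq_top_iff N hE, fun z hz hN ξ hξ => ?_⟩⟩
  · rw [scalar_compress, scalar_donoghueMeasure]
  · refine (scalar_donoghueMeasure_univ_eq_top_iff N hE ξ).2 fun hd => hξ (Subtype.ext ?_)
    exact eq_zero_of_mem_domain_of_mem_deficiencySpace hAdot.dense hs hext hz hd (hN ξ.2)
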